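/- **Setting.** A tensor network is a finite hypergraph: vertices are tensors, hyperedges are indices, and each hyperedge $e$ has a dimension size $\exp(w(e))\in\mathbb{N}_{\ge 1}$ and at least two ends, one of which may be free (dangling). For a vertex set $A$, let $E(A)$ be the set of hyperedges adjacent to $A$ that are also adjacent to a vertex outside $A$ or have a free end, and for disjoint $A,B$ let $E(A,B)$ be the set of hyperedges adjacent to both; $\mathrm{cut}(A)$ and $\mathrm{cut}(A,B)$ are the sums of $w$ over these sets. Contracting $A$ with $B$ costs $\exp(\mathrm{cut}(A)+\mathrm{cut}(B)-\mathrm{cut}(A,B))$, and a contraction tree (a rooted binary tree whose leaves are the vertices, each once) costs the sum of the costs of its contractions. The data network $G_D$ has vertex set $V_D$ and a set $\bar E$ of $N$ dangling edges to be sketched; each edge of $\bar E$ is adjacent to exactly one tensor, and each tensor to at most one edge of $\bar E$. A contraction tree $T_0$ of $G_D$ is given. An embedding $G_E$ is a graph with $N_E$ vertices; each edge of $\bar E$ joins the data to one embedding vertex, and every other embedding edge joins two distinct embedding vertices or is an output edge at one vertex. A contraction tree $T_B$ of $(G_D,G_E)$ is constrained on $T_0$ if for each contraction $(A,B)$ of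 $T_0$ there is a contraction $(\hat A,\hat B)$ of $T_B$ with $\hat A\cap V_D=A$ and $\hat B\cap V_D=B$. Fix $c_1,c_2>0$, and for $\epsilon>0$, $0<\delta<1$ put $\kappa=\log(1/\delta)/\epsilon^2$. Let $\mathcal{G}^{(\epsilon,\delta)}$ be the class of embeddings such that (i) for some ordering of the embedding vertices, at each vertex the product of the sizes of its output edges and of its edges to later vertices is at least $c_1N_E\kappa$; (ii) there is exactly one output edge, and its size, the sketch size, lies in $[c_1N_E\kappa,\;c_2N_E\kappa]$. **Algorithm 1** with sketch size $m$, when every data vertex is adjacent to an edge of $\bar E$. Each data tensor is contracted with its own matrix, adjacent to its edge in $\bar E$ (the Kronecker product embedding). Then for each contraction $(U,V)$ of $T_0$, in the order of $T_0$, a two-tensor network $Z$ is applied. With all quantities computed in the data network without $\bar E$, let $a=\exp(\mathrm{cut}(U)-\mathrm{cut}(U,V))$, $c=\exp(\mathrm{cut}(V)-\mathrm{cut}(U,V))$, $d=\exp(\mathrm{cut}(U\cup V))/(ac)$, $b=\exp(\mathrm{cut}(U,V))/d$; exchange $U$ and $V$ (and $a$ and $c$) if $a>c$. Put $\alpha=\min(m,\lceil\sqrt{mc/b}\,\rceil)$.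 The network $Z$ has tensors $v_1,v_2$ joined by an edge of size $m$. The sketched $U$, written $\hat U$, is connected to $v_1$ by an edge of size $m$; the sketched $V$, written $\hat V$, is connected to $v_1$ by an edge of size $\alpha$ and to $v_2$ by an edge of size $\lceil m/\alpha\rceil$. The output of $Z$ (or of a Kronecker matrix) leaves from $v_2$ (or from that matrix), and the contraction order is $(((\hat U,v_1),\hat V),v_2)$. The last tensor carries the output edge, of size $m$. This embedding has $3N-2$ vertices. **Theorem 4.2.** For all $c_1,c_2>0$ there is a constant $C>0$ such that the following holds for all $G_D$, $T_0$, $\epsilon>0$, $\delta\in(0,1)$ and integers $m\ge1$ with $c_1(3N-2)\kappa\le m\le c_2(3N-2)\kappa$. Suppose every vertex of $G_D$ is adjacent to an edge of $\bar E$, and every edge of $\bar E$ has size greater than $m$. Then the embedding of Algorithm 1 has sketch size $m$ and lies in $\mathcal{G}^{(\epsilon,\delta)}$, its contraction tree is a contraction tree of data and embedding constrained on $T_0$, and $$\mathrm{cost}(\text{Algorithm 1})\;\le\; C\cdot \mathrm{cost}(T_B)$$ for every $G_E\in\mathcal{G}^{(\epsilon,\delta)}$ with sketch size at least $c_1N\kappa$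 and every contraction tree $T_B$ of $(G_D,G_E)$ constrained on $T_0$. That is, Algorithm 1 has asymptotically optimal cost. -/

import Mathlib

namespace TNSketch

section

open scoped Classical

noncomputable section

/-- A (finite) tensor network on the vertex type `V`, given by a hypergraph with hyperedges `E`.
`ends e` is the set of tensors that share the index `e`, `dangling e` says that `e` has a free end
(an uncontracted index), and `dim e` is the dimension size of the index. Every hyperedge has at
least two ends, a free end counting as one. -/
structure TensorNetwork (V E : Type*) where
  ends : E → Finset V
  dangling : E → Prop
  dim : E → ℕ
  dim_pos : ∀ e, 0 < dim e
  ends_nonempty : ∀ e, (ends e).Nonempty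
  two_ends : ∀ e, ¬ dangling e → 2 ≤ (ends e).card

namespace TensorNetwork

variable {V E : Type*} [Fintype E] (G : TensorNetwork V E)

/-- `w(e)`, the natural logarithm of the dimension size. -/
def weight (e : E) : ℝ := Real.log (G.dim e)

/-- `E(A, B)`: the hyperedges adjacent to both `A` and `B`. -/
def edgesBetween (A B : Finset V) : Finset E :=
  Finset.univ.filter fun e => (∃ v ∈ G.ends e, v ∈ A) ∧ ∃ v ∈ G.ends e, v ∈ B

/-- `E(A)`: the hyperedges adjacent to `A` that also have an end outside `A`, either a vertex
outside `A` or a free end. These are the indices of the tensor obtained by contracting `A`. -/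
def edgesOf (A : Finset V) : Finset E :=
  Finset.univ.filter fun e =>
    (∃ v ∈ G.ends e, v ∈ A) ∧ ((∃ v ∈ G.ends e, v ∉ A) ∨ G.dangling e)

/-- `cut(A)`. -/
def cut (A : Finset V) : ℝ := ∑ e ∈ G.edgesOf A, G.weight e

/-- `cut(A, B)`. -/
def cutBetween (A B : Finset V) : ℝ := ∑ e ∈ G.edgesBetween A B, G.weight e

/-- The cost (up to a constant factor) of contracting the tensor of `A` with the tensor of `B`, for
disjoint `A` and `B`, by dense classical matrix multiplication. -/
def contractionCost (A B : Finset V) : ℝ :=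
  Real.exp (G.cut A + G.cut B - G.cutBetween A B)

end TensorNetwork

/-- Rooted binary trees with leaves labelled by `V`. -/
inductive ContractionTree (V : Type*) where
  | leaf (v : V) : ContractionTree V
  | node (l r : ContractionTree V) : ContractionTree V

namespace ContractionTree

variable {V : Type*}

/-- The labels of the leaves, from left to right. -/
def leaves : ContractionTree V → List V
  | leaf v => [v]
  | node l r => l.leaves ++ r.leaves

/-- The set of vertices that have been contracted at the root of the tree. -/
def verts (t : ContractionTree V) : Finset V := t.leaves.toFinset

/-- `t` is a contraction tree of a tensor network with vertex type `V`: every vertex is the label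
of exactly one leaf. -/
def IsFull (t : ContractionTree V) : Prop := t.leaves.Nodup ∧ ∀ v : V, v ∈ t.leaves

/-- The list of contractions `(A, B)` performed by the tree, one for each internal vertex. -/
def contractions : ContractionTree V → List (Finset V × Finset V)
  | leaf _ => []
  | node l r => (l.verts, r.verts) :: (l.contractions ++ r.contractions)

/-- The cost of a contraction tree: the sum of the costs of its contractions. -/
def cost {E : Type*} [Fintype E] (G : TensorNetwork V E) (t : ContractionTree V) : ℝ :=
  (t.contractions.map fun p => G.contractionCost p.1 p.2).sum

/-- `W ∩ V_D` for a set `W` of data and embedding vertices. -/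
def dataPart {VE : Type*} (W : Finset (V ⊕ VE)) : Finset V :=
  W.preimage Sum.inl Sum.inl_injective.injOn

/-- The contraction tree `T` of the data and the embedding is constrained on the contraction tree
`T₀` of the data: for every contraction `(A, B)` of `T₀` there is a contraction `(A', B')` of `T`
(contractions being unordered pairs) with `A' ∩ V_D = A` and `B' ∩ V_D = B`. -/
def ConstrainedOn {VE : Type*} (T : ContractionTree (V ⊕ VE)) (T₀ : ContractionTree V) : Prop :=
  ∀ p ∈ T₀.contractions, ∃ q ∈ T.contractions,
    (dataPart q.1 = p.1 ∧ dataPart q.2 = p.2) ∨ (dataPart q.1 = p.2 ∧ dataPart q.2 = p.1)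

end ContractionTree

/-- A data tensor network. `S` is the set of edges to be sketched, and `E` the set of all the other
hyperedges; `rest` is the network without the edges to be sketched. An edge to be sketched is
adjacent to only one tensor, and a tensor to at most one edge to be sketched. -/
structure DataNetwork (V E S : Type*) where
  rest : TensorNetwork V E
  vertex : S → V
  vertex_injective : Function.Injective vertex
  size : S → ℕ
  size_pos : ∀ s, 0 < size s

/-- A tensor network embedding for the edges `S` to be sketched, with graph structure. Besides the
edges in `S`, of which `s` is adjacent to the embedding vertex `input s`, it has edges `EE`, each
adjacent to two vertices (contracted) or to one vertex (uncontracted). -/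
structure Embedding (S VE EE : Type*) where
  input : S → VE
  ends : EE → Finset VE
  ends_card : ∀ f, (ends f).card = 1 ∨ (ends f).card = 2
  dim : EE → ℕ
  dim_pos : ∀ f, 0 < dim f

namespace Embedding

variable {S VE EE : Type*} [Fintype VE] [Fintype EE] (F : Embedding S VE EE)

/-- The uncontracted edges (output dimensions) of the embedding, other than those in `S`. -/
def outputs : Finset EE := Finset.univ.filter fun f => (F.ends f).card = 1

/-- The output sketch size. -/
def sketchSize : ℕ := ∏ f ∈ F.outputs, F.dim f

/-- The row size of the matricization of the tensor at `v`, for the ordering `ord` of the embedding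
vertices: the rows consist of the uncontracted dimensions at `v` and of the dimensions contracted
with a tensor of higher index. -/
def rowSize (ord : VE → ℕ) (v : VE) : ℕ :=
  ∏ f ∈ Finset.univ.filter
    (fun f => v ∈ F.ends f ∧ ((F.ends f).card = 1 ∨ ∃ u ∈ F.ends f, ord v < ord u)), F.dim f

end Embedding

/-- `n log(1/δ) / ε²`. -/
def scale (ε δ n : ℝ) : ℝ := n * Real.log (1 / δ) / ε ^ 2

namespace Embedding

variable {S VE EE : Type*} [Fintype VE] [Fintype EE] (F : Embedding S VE EE)

/-- The sufficient condition for `(ε, δ)`-accuracy, with constant `c`: in some linearization every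
row size is at least `c N_E log(1/δ) / ε²`, where `N_E` is the number of embedding vertices. -/
def SufficientlyAccurate (c ε δ : ℝ) : Prop :=
  ∃ ord : VE → ℕ, Function.Injective ord ∧
    ∀ v, c * scale ε δ (Fintype.card VE) ≤ F.rowSize ord v

/-- The class of embeddings that satisfy the sufficient condition and have only one output
dimension, of size `m = Θ(N_E log(1/δ) / ε²)`; `c₁` and `c₂` are the constants in the asymptotic
lower and upper bounds. -/
structure InClass (c₁ c₂ ε δ : ℝ) : Prop where
  one_output : F.outputs.card = 1
  accurate : F.SufficientlyAccurate c₁ ε δ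
  sketchSize_ge : c₁ * scale ε δ (Fintype.card VE) ≤ F.sketchSize
  sketchSize_le : (F.sketchSize : ℝ) ≤ c₂ * scale ε δ (Fintype.card VE)

end Embedding

namespace DataNetwork

variable {V E S : Type*} [Fintype E] (D : DataNetwork V E S)

/-- The overall tensor network of the data and the embedding. -/
def withEmbedding {VE EE : Type*} (F : Embedding S VE EE) :
    TensorNetwork (V ⊕ VE) (E ⊕ S ⊕ EE) where
  ends
    | .inl e => (D.rest.ends e).map Function.Embedding.inl
    | .inr (.inl s) => {Sum.inl (D.vertex s), Sum.inr (F.input s)}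
    | .inr (.inr f) => (F.ends f).map Function.Embedding.inr
  dangling
    | .inl e => D.rest.dangling e
    | .inr (.inl _) => False
    | .inr (.inr f) => (F.ends f).card = 1
  dim
    | .inl e => D.rest.dim e
    | .inr (.inl s) => D.size s
    | .inr (.inr f) => F.dim f
  dim_pos
    | .inl e => D.rest.dim_pos e
    | .inr (.inl s) => D.size_pos s
    | .inr (.inr f) => F.dim_pos f
  ends_nonempty
    | .inl e => by simpa using D.rest.ends_nonempty e
    | .inr (.inl s) => by simp
    | .inr (.inr f) => by
        rw [Finset.map_nonempty, ← Finset.card_pos]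
        rcases F.ends_card f with h | h <;> omega
  two_ends
    | .inl e => fun h => by simpa using D.rest.two_ends e h
    | .inr (.inl s) => fun _ => by simp
    | .inr (.inr f) => fun h => by
        rw [Finset.card_map]
        rcases F.ends_card f with h' | h'
        · exact absurd h' h
        · omega

/-- For a contraction `(A, B)` of the data, the size of the dimensions of `A` outside the edges to
be sketched that are not adjacent to `B`. For `(A, B) = (U_i, V_i)` this is `a_i`, and for
`(A, B) = (V_i, U_i)` it is `c_i`. -/
def outerSize (A B : Finset V) : ℝ := Real.exp (D.rest.cut A - D.rest.cutBetween A B)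

/-- `d_i`: the size of the dimensions adjacent to both `A` and `B` that remain after the
contraction. -/
def sharedSize (A B : Finset V) : ℝ :=
  Real.exp (D.rest.cut (A ∪ B)) / (D.outerSize A B * D.outerSize B A)

/-- `b_i`: the size of the dimensions contracted between `A` and `B`. -/
def contractedSize (A B : Finset V) : ℝ :=
  Real.exp (D.rest.cutBetween A B) / D.sharedSize A B

/-- The size `α` of the edge between the sketched `B` and the tensor that is applied to the
sketched `A`: the minimizer `√(m c / b)` of `a b d m² α + a c d m³ / α`, rounded up to an integer
and cut off at `m`. -/
def splitSize (m : ℕ) (A B : Finset V) : ℕ :=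
  min m ⌈Real.sqrt (m * D.outerSize B A / D.contractedSize A B)⌉₊

/-- The size `m / α`, rounded up, of the other edge that carries the sketch dimension of `B`. -/
def cosplitSize (m : ℕ) (A B : Finset V) : ℕ := ⌈(m : ℝ) / D.splitSize m A B⌉₊

lemma splitSize_pos {m : ℕ} (hm : 0 < m) (A B : Finset V) : 0 < D.splitSize m A B := by
  have hm' : (0 : ℝ) < m := Nat.cast_pos.mpr hm
  refine lt_min hm (Nat.ceil_pos.mpr (Real.sqrt_pos.mpr ?_))
  simp only [outerSize, contractedSize, sharedSize]
  positivity

lemma cosplitSize_pos {m : ℕ} (hm : 0 < m) (A B : Finset V) : 0 < D.cosplitSize m A B :=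
  Nat.ceil_pos.mpr
    (div_pos (Nat.cast_pos.mpr hm) (Nat.cast_pos.mpr (D.splitSize_pos hm A B)))

end DataNetwork

namespace ContractionTree

variable {V : Type*}

/-- The type of the contractions (internal vertices) of a tree; `none` is the one at the root. -/
def Contraction : ContractionTree V → Type
  | leaf _ => Empty
  | node l r => Option (l.Contraction ⊕ r.Contraction)

instance instFintypeContraction : (t : ContractionTree V) → Fintype t.Contraction
  | leaf _ => inferInstanceAs (Fintype Empty)
  | node l r =>
    letI := instFintypeContraction l
    letI := instFintypeContraction r
    inferInstanceAs (Fintype (Option (l.Contraction ⊕ r.Contraction)))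

/-- The vertex of the tree that is its root: a leaf or a contraction. -/
def root : (t : ContractionTree V) → V ⊕ t.Contraction
  | leaf v => .inl v
  | node _ _ => .inr none

/-- A vertex of the left subtree as a vertex of the whole tree. -/
def ofLeft {l r : ContractionTree V} : V ⊕ l.Contraction → V ⊕ (node l r).Contraction :=
  Sum.map id fun i => some (.inl i)

/-- A vertex of the right subtree as a vertex of the whole tree. -/
def ofRight {l r : ContractionTree V} : V ⊕ r.Contraction → V ⊕ (node l r).Contraction :=
  Sum.map id fun i => some (.inr i)

/-- The left child of a contraction. -/
def leftChild : (t : ContractionTree V) → t.Contraction → V ⊕ t.Contraction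
  | leaf _, i => Empty.elim i
  | node l _, none => ofLeft l.root
  | node l _, some (.inl i) => ofLeft (l.leftChild i)
  | node _ r, some (.inr i) => ofRight (r.leftChild i)

/-- The right child of a contraction. -/
def rightChild : (t : ContractionTree V) → t.Contraction → V ⊕ t.Contraction
  | leaf _, i => Empty.elim i
  | node _ r, none => ofRight r.root
  | node l _, some (.inl i) => ofLeft (l.rightChild i)
  | node _ r, some (.inr i) => ofRight (r.rightChild i)

/-- The set `U_i` of data vertices below the left child of the contraction `i`. -/
def leftVerts : (t : ContractionTree V) → t.Contraction → Finset V
  | leaf _, i => Empty.elim i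
  | node l _, none => l.verts
  | node l _, some (.inl i) => l.leftVerts i
  | node _ r, some (.inr i) => r.leftVerts i

/-- The set `V_i` of data vertices below the right child of the contraction `i`. -/
def rightVerts : (t : ContractionTree V) → t.Contraction → Finset V
  | leaf _, i => Empty.elim i
  | node _ r, none => r.verts
  | node l _, some (.inl i) => l.rightVerts i
  | node _ r, some (.inr i) => r.rightVerts i

lemma ofLeft_ne {l r : ContractionTree V} {x : V ⊕ l.Contraction} {i : l.Contraction}
    (h : x ≠ .inr i) : ofLeft (r := r) x ≠ .inr (some (.inl i)) := by
  rintro h'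
  rcases x with v | j
  · exact Sum.inl_ne_inr h'
  · exact h (congrArg Sum.inr (Sum.inl_injective (Option.some_injective _ (Sum.inr_injective h'))))

lemma ofRight_ne {l r : ContractionTree V} {x : V ⊕ r.Contraction} {i : r.Contraction}
    (h : x ≠ .inr i) : ofRight (l := l) x ≠ .inr (some (.inr i)) := by
  rintro h'
  rcases x with v | j
  · exact Sum.inl_ne_inr h'
  · exact h (congrArg Sum.inr (Sum.inr_injective (Option.some_injective _ (Sum.inr_injective h'))))

lemma ofLeft_ne_none {l r : ContractionTree V} (x : V ⊕ l.Contraction) :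
    ofLeft (r := r) x ≠ .inr none := by
  rintro h'
  rcases x with v | j
  · exact Sum.inl_ne_inr h'
  · exact Option.some_ne_none _ (Sum.inr_injective h')

lemma ofRight_ne_none {l r : ContractionTree V} (x : V ⊕ r.Contraction) :
    ofRight (l := l) x ≠ .inr none := by
  rintro h'
  rcases x with v | j
  · exact Sum.inl_ne_inr h'
  · exact Option.some_ne_none _ (Sum.inr_injective h')

lemma leftChild_ne : ∀ (t : ContractionTree V) (i : t.Contraction), t.leftChild i ≠ .inr i
  | leaf _, i => Empty.elim i
  | node _ _, none => ofLeft_ne_none _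
  | node l _, some (.inl i) => ofLeft_ne (l.leftChild_ne i)
  | node _ r, some (.inr i) => ofRight_ne (r.leftChild_ne i)

lemma rightChild_ne : ∀ (t : ContractionTree V) (i : t.Contraction), t.rightChild i ≠ .inr i
  | leaf _, i => Empty.elim i
  | node _ _, none => ofRight_ne_none _
  | node l _, some (.inl i) => ofLeft_ne (l.rightChild_ne i)
  | node _ r, some (.inr i) => ofRight_ne (r.rightChild_ne i)

end ContractionTree

namespace Alg

/-- The embedding vertices of the algorithm: a Kronecker factor (a matrix) for every edge to be
sketched, and for every contraction `i` of the data contraction tree a small network `Z_i` of the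
two tensors `(i, 0)` and `(i, 1)`, the first and the last one that are applied. `X` is the type of
the contractions. -/
abbrev Vertex (S X : Type*) := S ⊕ (X × Fin 2)

/-- The embedding edges of the algorithm: the output edge `none`, and four edges for every small
network. -/
abbrev Edge (X : Type*) := Option (X × Fin 4)

section

variable {V E S : Type*} [Fintype E] (D : DataNetwork V E S)
  (hD : Function.Surjective D.vertex)

/-- The edge to be sketched that is adjacent to the data vertex `v`. -/
def edgeAt (v : V) : S := Function.surjInv hD v

/-- The embedding tensor that carries the output sketch dimension of a vertex of the data
contraction tree: the Kronecker factor for a leaf, the last tensor of `Z_i` for the contraction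
`i`. -/
def outTensor {X : Type*} : V ⊕ X → Vertex S X
  | .inl v => .inl (edgeAt D hD v)
  | .inr i => .inr (i, 1)

/-- Whether in the contraction of `A` and `B` the operand `A` is sketched first: `a_i ≤ c_i`. -/
def LeftFirst (A B : Finset V) : Prop := D.outerSize A B ≤ D.outerSize B A

variable (T : ContractionTree V)

/-- The operand of the contraction `i` that is sketched first. -/
def firstChild (i : T.Contraction) : V ⊕ T.Contraction :=
  if LeftFirst D (T.leftVerts i) (T.rightVerts i) then T.leftChild i else T.rightChild i

/-- The other operand of the contraction `i`. -/
def secondChild (i : T.Contraction) : V ⊕ T.Contraction :=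
  if LeftFirst D (T.leftVerts i) (T.rightVerts i) then T.rightChild i else T.leftChild i

/-- The data vertices of the first operand. -/
def firstVerts (i : T.Contraction) : Finset V :=
  if LeftFirst D (T.leftVerts i) (T.rightVerts i) then T.leftVerts i else T.rightVerts i

/-- The data vertices of the second operand. -/
def secondVerts (i : T.Contraction) : Finset V :=
  if LeftFirst D (T.leftVerts i) (T.rightVerts i) then T.rightVerts i else T.leftVerts i

lemma outTensor_secondChild_ne (i : T.Contraction) :
    outTensor D hD (secondChild D T i) ≠ .inr (i, 1) := by
  have h : secondChild D T i ≠ .inr i := by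
    unfold secondChild
    split_ifs
    · exact T.rightChild_ne i
    · exact T.leftChild_ne i
  rcases hc : secondChild D T i with v | j
  · simp [outTensor]
  · rw [hc] at h
    simpa [outTensor] using h

/-- The embedding of the algorithm with sketch size `m`. For the contraction `i` with sketched
operands `P` (first) and `Q` (second), `Z_i` consists of the tensors `(i, 0)` and `(i, 1)`, joined
by an edge of size `m`; the sketch dimension of `P` is an edge of size `m` to `(i, 0)`; the sketch
dimension of `Q` is split into an edge of size `α` to `(i, 0)` and one of size `⌈m / α⌉` to
`(i, 1)`. The output edge is at the last tensor of all. -/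
def embedding (m : ℕ) (hm : 0 < m) :
    Embedding S (Vertex S T.Contraction) (Edge T.Contraction) where
  input s := .inl s
  ends
    | none => {outTensor D hD T.root}
    | some (i, 0) => {outTensor D hD (firstChild D T i), .inr (i, 0)}
    | some (i, 1) => {outTensor D hD (secondChild D T i), .inr (i, 0)}
    | some (i, 2) => {outTensor D hD (secondChild D T i), .inr (i, 1)}
    | some (i, 3) => {.inr (i, 0), .inr (i, 1)}
  ends_card
    | none => .inl (Finset.card_singleton _)
    | some (i, 0) => .inr (Finset.card_pair (by
        rcases firstChild D T i with v | j <;> simp [outTensor]))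
    | some (i, 1) => .inr (Finset.card_pair (by
        rcases secondChild D T i with v | j <;> simp [outTensor]))
    | some (i, 2) => .inr (Finset.card_pair (outTensor_secondChild_ne D hD T i))
    | some (i, 3) => .inr (Finset.card_pair (by simp))
  dim
    | none => m
    | some (_, 0) => m
    | some (i, 1) => D.splitSize m (firstVerts D T i) (secondVerts D T i)
    | some (i, 2) => D.cosplitSize m (firstVerts D T i) (secondVerts D T i)
    | some (_, 3) => m
  dim_pos
    | none => hm
    | some (_, 0) => hm
    | some (_, 1) => D.splitSize_pos hm _ _
    | some (_, 2) => D.cosplitSize_pos hm _ _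
    | some (_, 3) => hm

open ContractionTree in
/-- The part of the sketching contraction tree for a subtree of the data contraction tree, `f`
being the inclusion of the contractions of the subtree into those of the whole tree. A data tensor
is contracted with its Kronecker factor; a contraction of the data with sketched operands `P`
(first) and `Q` (second) becomes `(((P, (i, 0)), Q), (i, 1))`. -/
def treeAux {X : Type*} : (t : ContractionTree V) → (t.Contraction → X) →
    ContractionTree (V ⊕ Vertex S X)
  | leaf v, _ => node (leaf (.inl v)) (leaf (.inr (.inl (edgeAt D hD v))))
  | node l r, f =>
    let L := treeAux l fun i => f (some (.inl i))
    let R := treeAux r fun i => f (some (.inr i))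
    let z : Fin 2 → ContractionTree (V ⊕ Vertex S X) := fun k => leaf (.inr (.inr (f none, k)))
    if LeftFirst D l.verts r.verts then node (node (node L (z 0)) R) (z 1)
    else node (node (node R (z 0)) L) (z 1)

/-- The sketching contraction tree of the algorithm. -/
def tree : ContractionTree (V ⊕ Vertex S T.Contraction) := treeAux D hD T id

end

end Alg

end

end

end TNSketch

/-!
Order the data tensors before the embedding tensors. Then every tensor has a *row*, a set of edges
of size at least about `m` leading to later tensors or to the output, and rows of different tensors
are disjoint. For a set `A` of tensors with last tensor `x`, the row of `x` leaves `A`. Hence a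
contraction of a constrained tree costs at least the data cost times the rows of the last tensors of
both operands. The step of the tree that consumes the result, together with those that form the
operands, must in addition pay for the row of the earlier of the two last tensors, split into the
part that leads into the other operand and the part that does not; this gives
`exp (cut A) * exp (cut (A ∪ B)) * m ^ 5 ≤ L ^ 2` up to constants, where `L` is the largest of these
costs. The cost of the small network of the algorithm is the geometric balance of the two bounds,
which is the reason for the value of the split size `α`, and the sum over all contractions counts
every step of the tree at most four times.
-/

namespace TNSketch

section

open scoped Classical

/-! ### Cuts and costs of contraction trees -/

namespace TensorNetwork

variable {V E : Type*} (G : TensorNetwork V E)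

lemma exp_sum_weight (s : Finset E) :
    Real.exp (∑ e ∈ s, G.weight e) = ∏ e ∈ s, (G.dim e : ℝ) := by
  rw [Real.exp_sum]
  refine Finset.prod_congr rfl fun e _ => ?_
  rw [weight, Real.exp_log (Nat.cast_pos.mpr (G.dim_pos e))]

lemma one_le_prod_dim (s : Finset E) : (1 : ℝ) ≤ ∏ e ∈ s, (G.dim e : ℝ) := by
  exact_mod_cast Finset.prod_pos fun e _ => G.dim_pos e

lemma prod_dim_nonneg (s : Finset E) : (0 : ℝ) ≤ ∏ e ∈ s, (G.dim e : ℝ) :=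
  zero_le_one.trans (G.one_le_prod_dim s)

lemma prod_dim_mono {s t : Finset E} (h : s ⊆ t) :
    ∏ e ∈ s, (G.dim e : ℝ) ≤ ∏ e ∈ t, (G.dim e : ℝ) :=
  Finset.prod_le_prod_of_subset_of_one_le h (fun _ _ => Nat.cast_nonneg _)
    fun e _ _ => Nat.one_le_cast.mpr (G.dim_pos e)

variable [Fintype E]

lemma mem_edgesOf {A : Finset V} {e : E} : e ∈ G.edgesOf A ↔
    (∃ v ∈ G.ends e, v ∈ A) ∧ ((∃ v ∈ G.ends e, v ∉ A) ∨ G.dangling e) := by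
  simp [edgesOf]

lemma edgesOf_empty : G.edgesOf ∅ = ∅ := by
  ext e
  simp [mem_edgesOf]

lemma edgesOf_union_subset [DecidableEq V] [DecidableEq E] (A B : Finset V) :
    G.edgesOf (A ∪ B) ⊆ G.edgesOf A ∪ G.edgesOf B := by
  intro e
  simp only [Finset.mem_union, mem_edgesOf]
  grind

lemma edgesBetween_comm (A B : Finset V) : G.edgesBetween A B = G.edgesBetween B A := by
  ext e
  simp [edgesBetween, and_comm]

lemma edgesBetween_eq_inter [DecidableEq E] {A B : Finset V} (h : Disjoint A B) :
    G.edgesBetween A B = G.edgesOf A ∩ G.edgesOf B := by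
  ext e
  simp only [edgesBetween, Finset.mem_filter, Finset.mem_univ, true_and, Finset.mem_inter,
    mem_edgesOf]
  have := Finset.disjoint_left.mp h
  grind

lemma cutBetween_comm (A B : Finset V) : G.cutBetween A B = G.cutBetween B A := by
  rw [cutBetween, cutBetween, edgesBetween_comm]

lemma exp_cut (A : Finset V) : Real.exp (G.cut A) = ∏ e ∈ G.edgesOf A, (G.dim e : ℝ) :=
  G.exp_sum_weight _

lemma contractionCost_comm (A B : Finset V) :
    G.contractionCost A B = G.contractionCost B A := by
  rw [contractionCost, contractionCost, cutBetween_comm, add_comm (G.cut A)]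

lemma contractionCost_pos (A B : Finset V) : 0 < G.contractionCost A B := Real.exp_pos _

lemma contractionCost_eq_prod [DecidableEq E] {A B : Finset V} (h : Disjoint A B) :
    G.contractionCost A B = ∏ e ∈ G.edgesOf A ∪ G.edgesOf B, (G.dim e : ℝ) := by
  rw [contractionCost, ← exp_sum_weight, cut, cut, cutBetween, G.edgesBetween_eq_inter h,
    ← Finset.sum_union_inter, add_sub_cancel_right]

lemma contractionCost_le_prod [DecidableEq E] (A B : Finset V) :
    G.contractionCost A B ≤ ∏ e ∈ G.edgesOf A ∪ G.edgesOf B, (G.dim e : ℝ) := by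
  have hsub : G.edgesOf A ∩ G.edgesOf B ⊆ G.edgesBetween A B := by
    intro e
    simp only [edgesBetween, Finset.mem_filter, Finset.mem_univ, true_and, Finset.mem_inter,
      mem_edgesOf]
    tauto
  have hinter : ∑ e ∈ G.edgesOf A ∩ G.edgesOf B, G.weight e ≤ G.cutBetween A B :=
    Finset.sum_le_sum_of_subset_of_nonneg hsub fun e _ _ => Real.log_natCast_nonneg _
  rw [contractionCost, ← exp_sum_weight, Real.exp_le_exp, cut, cut, ← Finset.sum_union_inter]
  linarith

lemma prod_le_contractionCost [DecidableEq E] {A B : Finset V} (h : Disjoint A B) {s : Finset E}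
    (hs : s ⊆ G.edgesOf A ∪ G.edgesOf B) :
    ∏ e ∈ s, (G.dim e : ℝ) ≤ G.contractionCost A B := by
  rw [G.contractionCost_eq_prod h]
  exact G.prod_dim_mono hs

/-- The tensor of `A` is a single tensor of the network, or it is the result of a contraction of
cost at most `L`. -/
def IsFormedWithin [DecidableEq V] (A : Finset V) (L : ℝ) : Prop :=
  (∃ x, A = {x}) ∨ ∃ A₁ A₂ : Finset V, A₁.Nonempty ∧ A₂.Nonempty ∧ Disjoint A₁ A₂ ∧
    A₁ ∪ A₂ = A ∧ G.contractionCost A₁ A₂ ≤ L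

/-- The tensor of `A` is the whole contracted network, or it is an operand of a contraction of cost
at most `L`. -/
def IsConsumedWithin (A : Finset V) (L : ℝ) : Prop :=
  (∀ w, w ∈ A) ∨ ∃ B : Finset V, B.Nonempty ∧ Disjoint A B ∧ G.contractionCost A B ≤ L

variable {G} in
lemma IsFormedWithin.mono [DecidableEq V] {A : Finset V} {L L' : ℝ} (h : G.IsFormedWithin A L)
    (hL : L ≤ L') : G.IsFormedWithin A L' :=
  h.imp_right fun ⟨A₁, A₂, h₁, h₂, hd, hA, hc⟩ => ⟨A₁, A₂, h₁, h₂, hd, hA, hc.trans hL⟩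

variable {G} in
lemma IsConsumedWithin.mono {A : Finset V} {L L' : ℝ} (h : G.IsConsumedWithin A L)
    (hL : L ≤ L') : G.IsConsumedWithin A L' :=
  h.imp_right fun ⟨B, hB, hd, hc⟩ => ⟨B, hB, hd, hc.trans hL⟩

end TensorNetwork

namespace ContractionTree

section Vertices

variable {V : Type*}

lemma leaves_ne_nil : ∀ t : ContractionTree V, t.leaves ≠ []
  | leaf _ => by simp [leaves]
  | node l r => by simp [leaves, leaves_ne_nil l]

lemma mem_verts {t : ContractionTree V} {v : V} : v ∈ t.verts ↔ v ∈ t.leaves :=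
  List.mem_toFinset

lemma verts_nonempty (t : ContractionTree V) : t.verts.Nonempty := by
  simpa [verts] using t.leaves_ne_nil

lemma verts_leaf (v : V) : (leaf v).verts = {v} := by
  simp [verts, leaves]

lemma verts_node [DecidableEq V] (l r : ContractionTree V) :
    (node l r).verts = l.verts ∪ r.verts := by
  ext v
  simp [verts, leaves]

lemma nodup_leaves_node {l r : ContractionTree V} : (node l r).leaves.Nodup ↔
    l.leaves.Nodup ∧ r.leaves.Nodup ∧ Disjoint l.verts r.verts := by
  rw [leaves, List.nodup_append', Finset.disjoint_left]
  simp only [mem_verts, List.Disjoint]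

lemma card_contraction : ∀ t : ContractionTree V,
    Fintype.card t.Contraction + 1 = t.leaves.length
  | leaf _ => rfl
  | node l r => by
      have h : Fintype.card (node l r).Contraction =
          Fintype.card l.Contraction + Fintype.card r.Contraction + 1 :=
        (Fintype.card_option (α := l.Contraction ⊕ r.Contraction)).trans
          (congrArg (· + 1) Fintype.card_sum)
      rw [h, leaves, List.length_append, ← card_contraction l, ← card_contraction r]
      omega

lemma sum_contraction_node {l r : ContractionTree V} (f : (node l r).Contraction → ℝ) :
    ∑ i, f i = f none + (∑ i, f (some (.inl i)) + ∑ i, f (some (.inr i))) :=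
  (Fintype.sum_option (α := l.Contraction ⊕ r.Contraction) f).trans
    (congrArg _ (Fintype.sum_sum_type _))

lemma exists_contraction_node {l r : ContractionTree V} {p : (node l r).Contraction → Prop} :
    (∃ i, p i) ↔ p none ∨ (∃ i, p (some (.inl i))) ∨ ∃ i, p (some (.inr i)) :=
  (Option.exists (α := l.Contraction ⊕ r.Contraction)).trans (or_congr_right Sum.exists)

lemma mem_contractions_iff {p : Finset V × Finset V} : ∀ {t : ContractionTree V},
    p ∈ t.contractions ↔ ∃ i, p = (t.leftVerts i, t.rightVerts i)
  | leaf _ => ⟨fun h => by simp [contractions] at h, fun ⟨i, _⟩ => Empty.elim i⟩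
  | node l r => by
      rw [contractions, List.mem_cons, List.mem_append, mem_contractions_iff,
        mem_contractions_iff, exists_contraction_node]
      rfl

lemma leftVerts_nonempty : ∀ (t : ContractionTree V) (i : t.Contraction),
    (t.leftVerts i).Nonempty
  | leaf _, i => Empty.elim i
  | node l _, none => l.verts_nonempty
  | node l _, some (.inl i) => l.leftVerts_nonempty i
  | node _ r, some (.inr i) => r.leftVerts_nonempty i

lemma rightVerts_nonempty : ∀ (t : ContractionTree V) (i : t.Contraction),
    (t.rightVerts i).Nonempty
  | leaf _, i => Empty.elim i
  | node _ r, none => r.verts_nonempty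
  | node l _, some (.inl i) => l.rightVerts_nonempty i
  | node _ r, some (.inr i) => r.rightVerts_nonempty i

lemma disjoint_leftVerts_rightVerts : ∀ (t : ContractionTree V), t.leaves.Nodup →
    ∀ i : t.Contraction, Disjoint (t.leftVerts i) (t.rightVerts i)
  | leaf _, _, i => Empty.elim i
  | node _ _, h, none => (nodup_leaves_node.mp h).2.2
  | node l _, h, some (.inl i) => l.disjoint_leftVerts_rightVerts (nodup_leaves_node.mp h).1 i
  | node _ r, h, some (.inr i) => r.disjoint_leftVerts_rightVerts (nodup_leaves_node.mp h).2.1 i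

lemma leftVerts_union_rightVerts_subset [DecidableEq V] : ∀ (t : ContractionTree V)
    (i : t.Contraction), t.leftVerts i ∪ t.rightVerts i ⊆ t.verts
  | leaf _, i => Empty.elim i
  | node l r, none => (verts_node l r).ge
  | node l r, some (.inl i) => (l.leftVerts_union_rightVerts_subset i).trans
      (by rw [verts_node]; exact Finset.subset_union_left)
  | node l r, some (.inr i) => (r.leftVerts_union_rightVerts_subset i).trans
      (by rw [verts_node]; exact Finset.subset_union_right)

lemma leftVerts_union_rightVerts_injective [DecidableEq V] : ∀ (t : ContractionTree V),
    t.leaves.Nodup → Function.Injective fun i : t.Contraction => t.leftVerts i ∪ t.rightVerts i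
  | leaf _, _ => fun i => Empty.elim i
  | node l r, h => by
      obtain ⟨hl, hr, hd⟩ := nodup_leaves_node.mp h
      have hL := l.leftVerts_union_rightVerts_subset
      have hR := r.leftVerts_union_rightVerts_subset
      have not_right_subset (i) : ¬ r.verts ⊆ l.leftVerts i ∪ l.rightVerts i := fun h' =>
        r.verts_nonempty.ne_empty (hd.eq_bot_of_ge (h'.trans (hL i)))
      have not_left_subset (i) : ¬ l.verts ⊆ r.leftVerts i ∪ r.rightVerts i := fun h' =>
        l.verts_nonempty.ne_empty (hd.eq_bot_of_le (h'.trans (hR i)))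
      have left_ne_right (i j) :
          l.leftVerts i ∪ l.rightVerts i ≠ r.leftVerts j ∪ r.rightVerts j := fun h' =>
        ((l.leftVerts_nonempty i).mono Finset.subset_union_left).ne_empty
          ((hd.mono (hL i) (hR j)).eq_bot_of_le h'.le)
      rintro (_ | i | i) (_ | j | j) hij
      · rfl
      · exact (not_right_subset j (Finset.subset_union_right.trans_eq hij)).elim
      · exact (not_left_subset j (Finset.subset_union_left.trans_eq hij)).elim
      · exact (not_right_subset i (Finset.subset_union_right.trans_eq hij.symm)).elim
      · exact congrArg (some ∘ Sum.inl) (l.leftVerts_union_rightVerts_injective hl hij)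
      · exact (left_ne_right i j hij).elim
      · exact (not_left_subset i (Finset.subset_union_left.trans_eq hij.symm)).elim
      · exact (left_ne_right j i hij.symm).elim
      · exact congrArg (some ∘ Sum.inr) (r.leftVerts_union_rightVerts_injective hr hij)

end Vertices

section Cost

variable {V E : Type*} [Fintype E] (G : TensorNetwork V E)

lemma cost_leaf (v : V) : (leaf v).cost G = 0 := by simp [cost, contractions]

lemma cost_node (l r : ContractionTree V) :
    (node l r).cost G = G.contractionCost l.verts r.verts + (l.cost G + r.cost G) := by
  simp [cost, contractions]

lemma cost_nonneg (t : ContractionTree V) : 0 ≤ t.cost G := by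
  refine List.sum_nonneg fun c hc => ?_
  obtain ⟨p, -, rfl⟩ := List.mem_map.mp hc
  exact (G.contractionCost_pos _ _).le

/-- The cost of the last contraction of a tree, `0` for a single leaf. -/
noncomputable def topCost : ContractionTree V → ℝ
  | leaf _ => 0
  | node l r => G.contractionCost l.verts r.verts

lemma topCost_nonneg : ∀ t : ContractionTree V, 0 ≤ t.topCost G
  | leaf _ => le_rfl
  | node l r => (G.contractionCost_pos l.verts r.verts).le

lemma isFormedWithin_verts [DecidableEq V] : ∀ t : ContractionTree V, t.leaves.Nodup →
    G.IsFormedWithin t.verts (t.topCost G)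
  | leaf v, _ => .inl ⟨v, verts_leaf v⟩
  | node l r, h => .inr ⟨l.verts, r.verts, l.verts_nonempty, r.verts_nonempty,
      (nodup_leaves_node.mp h).2.2, (verts_node l r).symm, le_rfl⟩

/-- The total cost of a contraction, of the contractions that form its operands, and of the one
that consumes its result, which is taken to be `π` at the root. -/
noncomputable def neighborCost : ℝ → (t : ContractionTree V) → t.Contraction → ℝ
  | _, leaf _, i => Empty.elim i
  | π, node l r, none => G.contractionCost l.verts r.verts + l.topCost G + r.topCost G + π
  | _, node l r, some (.inl i) => neighborCost (G.contractionCost l.verts r.verts) l i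
  | _, node l r, some (.inr i) => neighborCost (G.contractionCost l.verts r.verts) r i

lemma sum_neighborCost_le : ∀ (t : ContractionTree V) {π : ℝ}, 0 ≤ π →
    ∑ i, neighborCost G π t i ≤ 4 * t.cost G - t.topCost G + π
  | leaf v, π, hπ => by
      have h : ∑ i, neighborCost G π (leaf v) i = 0 := Finset.sum_empty
      simpa [h, cost_leaf, topCost] using hπ
  | node l r, π, _ => by
      have hc := (G.contractionCost_pos l.verts r.verts).le
      have hl := sum_neighborCost_le l hc
      have hr := sum_neighborCost_le r hc
      have htop : (node l r).topCost G = G.contractionCost l.verts r.verts := rfl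
      rw [sum_contraction_node, cost_node, htop]
      simp only [neighborCost]
      linarith

lemma contractionCost_le_neighborCost : ∀ (t : ContractionTree V) {π : ℝ}, 0 ≤ π →
    ∀ i, G.contractionCost (t.leftVerts i) (t.rightVerts i) ≤ neighborCost G π t i
  | leaf _, _, _, i => Empty.elim i
  | node l r, _, hπ, none => by
      have hl := l.topCost_nonneg G
      have hr := r.topCost_nonneg G
      simp only [neighborCost, leftVerts, rightVerts]
      linarith
  | node l r, _, _, some (.inl i) =>
      contractionCost_le_neighborCost l (G.contractionCost_pos l.verts r.verts).le i
  | node l r, _, _, some (.inr i) =>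
      contractionCost_le_neighborCost r (G.contractionCost_pos l.verts r.verts).le i

lemma neighborCost_pos (t : ContractionTree V) {π : ℝ} (hπ : 0 ≤ π) (i : t.Contraction) :
    0 < neighborCost G π t i :=
  (G.contractionCost_pos _ _).trans_le (contractionCost_le_neighborCost G t hπ i)

lemma isFormedWithin_operands [DecidableEq V] : ∀ (t : ContractionTree V), t.leaves.Nodup →
    ∀ {π : ℝ}, 0 ≤ π → ∀ i, G.IsFormedWithin (t.leftVerts i) (neighborCost G π t i) ∧
      G.IsFormedWithin (t.rightVerts i) (neighborCost G π t i)
  | leaf _, _, _, _, i => Empty.elim i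
  | node l r, h, _, hπ, none => by
      obtain ⟨hnl, hnr, -⟩ := nodup_leaves_node.mp h
      have hc := G.contractionCost_pos l.verts r.verts
      have hl := l.topCost_nonneg G
      have hr := r.topCost_nonneg G
      refine ⟨(isFormedWithin_verts G l hnl).mono ?_, (isFormedWithin_verts G r hnr).mono ?_⟩ <;>
        simp only [neighborCost] <;> linarith
  | node l r, h, _, _, some (.inl i) => isFormedWithin_operands l (nodup_leaves_node.mp h).1
      (G.contractionCost_pos l.verts r.verts).le i
  | node l r, h, _, _, some (.inr i) => isFormedWithin_operands r (nodup_leaves_node.mp h).2.1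
      (G.contractionCost_pos l.verts r.verts).le i

lemma isConsumedWithin_result [DecidableEq V] : ∀ (t : ContractionTree V), t.leaves.Nodup →
    ∀ {π : ℝ}, 0 ≤ π → G.IsConsumedWithin t.verts π →
      ∀ i, G.IsConsumedWithin (t.leftVerts i ∪ t.rightVerts i) (neighborCost G π t i)
  | leaf _, _, _, _, _, i => Empty.elim i
  | node l r, _, _, _, hcons, none => by
      have hc := G.contractionCost_pos l.verts r.verts
      have hl := l.topCost_nonneg G
      have hr := r.topCost_nonneg G
      rw [verts_node] at hcons
      refine hcons.mono ?_
      simp only [neighborCost]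
      linarith
  | node l r, h, _, _, _, some (.inl i) => by
      obtain ⟨hl, -, hd⟩ := nodup_leaves_node.mp h
      exact isConsumedWithin_result l hl (G.contractionCost_pos _ _).le
        (.inr ⟨r.verts, r.verts_nonempty, hd, le_rfl⟩) i
  | node l r, h, _, _, _, some (.inr i) => by
      obtain ⟨-, hr, hd⟩ := nodup_leaves_node.mp h
      exact isConsumedWithin_result r hr (G.contractionCost_pos _ _).le
        (.inr ⟨l.verts, l.verts_nonempty, hd.symm, (G.contractionCost_comm _ _).le⟩) i

lemma sum_leaves_le_add {g : V → ℝ}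
    (hg : ∀ x (B : Finset V), B.Nonempty → Disjoint {x} B → g x ≤ G.contractionCost {x} B) :
    ∀ t : ContractionTree V, t.leaves.Nodup → ∀ B : Finset V, B.Nonempty → Disjoint t.verts B →
      (t.leaves.map g).sum ≤ 2 * t.cost G + G.contractionCost t.verts B
  | leaf v, _, B, hB, hd => by
      rw [verts_leaf] at hd ⊢
      simpa [leaves, cost_leaf] using hg v B hB hd
  | node l r, h, B, _, _ => by
      obtain ⟨hl, hr, hd⟩ := nodup_leaves_node.mp h
      have hsuml := sum_leaves_le_add hg l hl _ r.verts_nonempty hd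
      have hsumr := sum_leaves_le_add hg r hr _ l.verts_nonempty hd.symm
      rw [G.contractionCost_comm] at hsumr
      have hB := G.contractionCost_pos (node l r).verts B
      rw [leaves, List.map_append, List.sum_append, cost_node]
      linarith

/-- Every leaf is charged to the contraction that consumes it, and a contraction has only two
operands. -/
lemma sum_verts_node_le {g : V → ℝ}
    (hg : ∀ x (B : Finset V), B.Nonempty → Disjoint {x} B → g x ≤ G.contractionCost {x} B)
    {l r : ContractionTree V} (h : (node l r).leaves.Nodup) :
    ∑ x ∈ (node l r).verts, g x ≤ 2 * (node l r).cost G := by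
  obtain ⟨hl, hr, hd⟩ := nodup_leaves_node.mp h
  have hsuml := sum_leaves_le_add G hg l hl _ r.verts_nonempty hd
  have hsumr := sum_leaves_le_add G hg r hr _ l.verts_nonempty hd.symm
  rw [G.contractionCost_comm] at hsumr
  rw [verts, List.sum_toFinset _ h, leaves, List.map_append, List.sum_append, cost_node]
  linarith

end Cost

end ContractionTree

/-! ### Row systems -/

namespace TensorNetwork

/-- An ordering of the tensors together with pairwise disjoint sets of edges, the rows, of size at
least `κ`: every edge in the row of a tensor leads to a later tensor or is dangling, and at most one
edge of all the rows is dangling. -/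
structure RowSystem {W E : Type*} (G : TensorNetwork W E) (κ : ℝ) where
  ord : W → ℕ
  row : W → Finset E
  mem_ends : ∀ x, ∀ e ∈ row x, x ∈ G.ends e
  exits : ∀ x, ∀ e ∈ row x, G.dangling e ∨ ∃ y ∈ G.ends e, ord x < ord y
  disjoint_row : ∀ x y, x ≠ y → Disjoint (row x) (row y)
  le_prod : ∀ x, κ ≤ ∏ e ∈ row x, (G.dim e : ℝ)
  dangling_unique : ∀ x y, ∀ e ∈ row x, ∀ f ∈ row y, G.dangling e → G.dangling f → e = f

namespace RowSystem

variable {W E : Type*} {G : TensorNetwork W E} {κ : ℝ} (R : RowSystem G κ)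

/-- `x` is a last tensor of `A` in the ordering of the row system. -/
def IsLast (x : W) (A : Finset W) : Prop := x ∈ A ∧ ∀ y ∈ A, R.ord y ≤ R.ord x

lemma exists_isLast {A : Finset W} (hA : A.Nonempty) : ∃ x, R.IsLast x A :=
  A.exists_max_image R.ord hA

variable {R}

lemma IsLast.of_subset {x : W} {A B : Finset W} (h : R.IsLast x B) (hAB : A ⊆ B) (hx : x ∈ A) :
    R.IsLast x A :=
  ⟨hx, fun y hy => h.2 y (hAB hy)⟩

lemma IsLast.union [DecidableEq W] {x y : W} {A B : Finset W} (hx : R.IsLast x A)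
    (hy : R.IsLast y B) (hyx : R.ord y ≤ R.ord x) : R.IsLast x (A ∪ B) :=
  ⟨Finset.mem_union_left _ hx.1, fun z hz =>
    (Finset.mem_union.mp hz).elim (hx.2 z) fun hzB => (hy.2 z hzB).trans hyx⟩

lemma IsLast.row_subset_edgesOf [Fintype E] {x : W} {A : Finset W} (hx : R.IsLast x A) :
    R.row x ⊆ G.edgesOf A := fun e he =>
  G.mem_edgesOf.mpr ⟨⟨x, R.mem_ends x e he, hx.1⟩, (R.exits x e he).symm.imp_left
    fun ⟨y, hy, hlt⟩ => ⟨y, hy, fun hyA => (hx.2 y hyA).not_gt hlt⟩⟩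

variable (R)

/-- The edges in the row of `y` that are adjacent to `A`. -/
noncomputable def rowTo (y : W) (A : Finset W) : Finset E :=
  (R.row y).filter fun e => ∃ v ∈ G.ends e, v ∈ A

/-- The edges in the row of `y` that are not adjacent to `A`. -/
noncomputable def rowAway (y : W) (A : Finset W) : Finset E :=
  (R.row y).filter fun e => ¬ ∃ v ∈ G.ends e, v ∈ A

lemma mem_rowTo {y : W} {A : Finset W} {e : E} :
    e ∈ R.rowTo y A ↔ e ∈ R.row y ∧ ∃ v ∈ G.ends e, v ∈ A :=
  Finset.mem_filter

lemma mem_rowAway {y : W} {A : Finset W} {e : E} :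
    e ∈ R.rowAway y A ↔ e ∈ R.row y ∧ ¬ ∃ v ∈ G.ends e, v ∈ A :=
  Finset.mem_filter

lemma rowTo_subset (y : W) (A : Finset W) : R.rowTo y A ⊆ R.row y := Finset.filter_subset _ _

lemma rowAway_subset (y : W) (A : Finset W) : R.rowAway y A ⊆ R.row y := Finset.filter_subset _ _

lemma le_rowTo_mul_rowAway (y : W) (A : Finset W) :
    κ ≤ (∏ e ∈ R.rowTo y A, (G.dim e : ℝ)) * ∏ e ∈ R.rowAway y A, (G.dim e : ℝ) := by
  rw [rowTo, rowAway, Finset.prod_filter_mul_prod_filter_not]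
  exact R.le_prod y

lemma rowTo_subset_edgesOf [Fintype E] {y : W} {A : Finset W} (hy : y ∉ A) :
    R.rowTo y A ⊆ G.edgesOf A := by
  intro e he
  obtain ⟨her, hA⟩ := R.mem_rowTo.mp he
  exact G.mem_edgesOf.mpr ⟨hA, .inl ⟨y, R.mem_ends y e her, hy⟩⟩

variable {R} {A B : Finset W} {x y z : W}

lemma IsLast.exits_of_mem_rowAway [DecidableEq W] (hy : R.IsLast y B) {e : E}
    (he : e ∈ R.rowAway y A) : (∃ v ∈ G.ends e, v ∉ A ∪ B) ∨ G.dangling e := by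
  obtain ⟨her, hA⟩ := R.mem_rowAway.mp he
  refine (R.exits y e her).symm.imp_left fun ⟨z, hz, hlt⟩ => ⟨z, hz, fun hAB => ?_⟩
  exact (Finset.mem_union.mp hAB).elim (fun h => hA ⟨z, hz, h⟩) fun h => (hy.2 z h).not_gt hlt

lemma IsLast.rowAway_subset_edgesOf [DecidableEq W] [Fintype E] (hy : R.IsLast y B) :
    R.rowAway y A ⊆ G.edgesOf (A ∪ B) := fun e he =>
  G.mem_edgesOf.mpr ⟨⟨y, R.mem_ends y e (R.rowAway_subset _ _ he),
    Finset.mem_union_right _ hy.1⟩, hy.exits_of_mem_rowAway he⟩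

/-- Both rows could only use the one dangling edge, and the row of `x` takes it. -/
lemma rowAway_eq_empty_of_univ [DecidableEq W] (hAB : Disjoint A B) (hx : R.IsLast x A)
    (hy : R.IsLast y B) (hyx : R.ord y ≤ R.ord x) (huniv : ∀ w, w ∈ A ∪ B) (hκ : 1 < κ) :
    R.rowAway y A = ∅ := by
  refine Finset.eq_empty_of_forall_notMem fun e he => ?_
  have hed : G.dangling e :=
    (hy.exits_of_mem_rowAway he).resolve_left fun ⟨v, _, hv⟩ => hv (huniv v)
  have hxy : x ≠ y := fun h => Finset.disjoint_left.mp hAB hx.1 (h ▸ hy.1)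
  obtain ⟨f, hf⟩ : (R.row x).Nonempty := by
    refine Finset.nonempty_iff_ne_empty.mpr fun h => hκ.not_ge ?_
    simpa [h] using R.le_prod x
  have hfd : G.dangling f := (R.exits x f hf).resolve_right fun ⟨w, _, hw⟩ =>
    ((hx.union hy hyx).2 w (huniv w)).not_gt hw
  have hfe := R.dangling_unique x y f hf e (R.rowAway_subset _ _ he) hfd hed
  exact Finset.disjoint_left.mp (R.disjoint_row x y hxy) hf (hfe ▸ R.rowAway_subset _ _ he)

lemma le_prod_rowTo_of_univ [DecidableEq W] (hAB : Disjoint A B) (hx : R.IsLast x A)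
    (hy : R.IsLast y B) (hyx : R.ord y ≤ R.ord x) (huniv : ∀ w, w ∈ A ∪ B) :
    κ ≤ ∏ e ∈ R.rowTo y A, (G.dim e : ℝ) := by
  rcases le_or_gt κ 1 with hκ | hκ
  · exact hκ.trans (G.one_le_prod_dim _)
  · simpa [rowAway_eq_empty_of_univ hAB hx hy hyx huniv hκ] using R.le_rowTo_mul_rowAway y A

variable [Fintype E] {X Y : Finset E} {L : ℝ}

lemma prod_mul_rows_le_contractionCost [DecidableEq E] (hAB : Disjoint A B)
    (hx : R.IsLast x A) (hz : R.IsLast z B) (hX : X ⊆ G.edgesOf A ∪ G.edgesOf B)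
    (hXx : Disjoint X (R.row x)) (hXz : Disjoint X (R.row z)) :
    (∏ e ∈ X, (G.dim e : ℝ)) * ((∏ e ∈ R.row x, (G.dim e : ℝ)) * ∏ e ∈ R.row z, (G.dim e : ℝ)) ≤
      G.contractionCost A B := by
  have hxz : x ≠ z := fun h => Finset.disjoint_left.mp hAB hx.1 (h ▸ hz.1)
  rw [← Finset.prod_union (R.disjoint_row x z hxz),
    ← Finset.prod_union (Finset.disjoint_union_right.mpr ⟨hXx, hXz⟩)]
  exact G.prod_le_contractionCost hAB (Finset.union_subset hX
    (Finset.union_subset_union hx.row_subset_edgesOf hz.row_subset_edgesOf))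

lemma prod_mul_sq_le_contractionCost [DecidableEq E] (hκ : 0 ≤ κ) (hAB : Disjoint A B)
    (hx : R.IsLast x A) (hz : R.IsLast z B) (hX : X ⊆ G.edgesOf A ∪ G.edgesOf B)
    (hXx : Disjoint X (R.row x)) (hXz : Disjoint X (R.row z)) :
    (∏ e ∈ X, (G.dim e : ℝ)) * κ ^ 2 ≤ G.contractionCost A B := by
  refine le_trans ?_ (prod_mul_rows_le_contractionCost hAB hx hz hX hXx hXz)
  have := G.prod_dim_nonneg X
  have := R.le_prod x
  have := R.le_prod z
  rw [sq]
  gcongr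

lemma prod_mul_prod_mul_sq_le_contractionCost [DecidableEq E] (hκ : 0 ≤ κ) (hAB : Disjoint A B)
    (hx : R.IsLast x A) (hz : R.IsLast z B) (hX : X ⊆ G.edgesOf A ∪ G.edgesOf B)
    (hXrow : ∀ w, Disjoint X (R.row w)) (hY : Y ⊆ G.edgesOf A ∪ G.edgesOf B) (hYy : Y ⊆ R.row y)
    (hyx : y ≠ x) (hyz : y ≠ z) :
    (∏ e ∈ X, (G.dim e : ℝ)) * (κ ^ 2 * ∏ e ∈ Y, (G.dim e : ℝ)) ≤ G.contractionCost A B := by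
  have hdisj (w) (hw : y ≠ w) : Disjoint (X ∪ Y) (R.row w) :=
    Finset.disjoint_union_left.mpr ⟨hXrow w, (R.disjoint_row y w hw).mono_left hYy⟩
  have hle := prod_mul_sq_le_contractionCost hκ hAB hx hz (Finset.union_subset hX hY)
    (hdisj x hyx) (hdisj z hyz)
  rw [Finset.prod_union ((hXrow y).mono_right hYy)] at hle
  linarith

lemma prod_mul_rowTo_le_contractionCost [DecidableEq W] (hκ : 0 ≤ κ) (hx : R.IsLast x A)
    (hy : y ∉ A) (hXrow : ∀ w, Disjoint X (R.row w)) (hX : X ⊆ G.edgesOf A) {A₁ A₂ : Finset W}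
    (h₁ : A₁.Nonempty) (h₂ : A₂.Nonempty) (hd : Disjoint A₁ A₂) (hA : A₁ ∪ A₂ = A) :
    (∏ e ∈ X, (G.dim e : ℝ)) * (κ ^ 2 * ∏ e ∈ R.rowTo y A, (G.dim e : ℝ)) ≤
      G.contractionCost A₁ A₂ := by
  wlog hx₁ : x ∈ A₁ generalizing A₁ A₂
  · rw [G.contractionCost_comm]
    refine this h₂ h₁ hd.symm (by rw [Finset.union_comm, hA]) ?_
    exact (Finset.mem_union.mp (hA ▸ hx.1)).resolve_left hx₁
  obtain ⟨z, hz⟩ := R.exists_isLast h₂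
  have hsub : G.edgesOf A ⊆ G.edgesOf A₁ ∪ G.edgesOf A₂ := hA ▸ G.edgesOf_union_subset A₁ A₂
  have hzA : z ∈ A := hA ▸ Finset.mem_union_right _ hz.1
  exact prod_mul_prod_mul_sq_le_contractionCost hκ hd
    (hx.of_subset (hA ▸ Finset.subset_union_left) hx₁) hz (hX.trans hsub) hXrow
    ((R.rowTo_subset_edgesOf hy).trans hsub) (R.rowTo_subset y A)
    (ne_of_mem_of_not_mem hx.1 hy).symm (ne_of_mem_of_not_mem hzA hy).symm

lemma prod_mul_rowAway_le_contractionCost [DecidableEq W] (hκ : 0 ≤ κ) (hAB : Disjoint A B)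
    (hx : R.IsLast x A) (hy : R.IsLast y B) (hyx : R.ord y ≤ R.ord x)
    (hXrow : ∀ w, Disjoint X (R.row w)) (hX : X ⊆ G.edgesOf (A ∪ B)) {C : Finset W}
    (hC : C.Nonempty) (hd : Disjoint (A ∪ B) C) :
    (∏ e ∈ X, (G.dim e : ℝ)) * (κ ^ 2 * ∏ e ∈ R.rowAway y A, (G.dim e : ℝ)) ≤
      G.contractionCost (A ∪ B) C := by
  obtain ⟨z, hz⟩ := R.exists_isLast hC
  have hyz : y ≠ z := fun h =>
    Finset.disjoint_left.mp hd (Finset.mem_union_right _ hy.1) (h ▸ hz.1)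
  have hne : y ≠ x := fun h => Finset.disjoint_left.mp hAB hx.1 (h ▸ hy.1)
  exact prod_mul_prod_mul_sq_le_contractionCost hκ hd (hx.union hy hyx) hz
    (hX.trans Finset.subset_union_left) hXrow
    (hy.rowAway_subset_edgesOf.trans Finset.subset_union_left) (R.rowAway_subset y A) hne hyz

lemma prod_mul_rowTo_le [DecidableEq W] (hκ : 0 ≤ κ) (hAB : Disjoint A B) (hx : R.IsLast x A)
    (hy : R.IsLast y B) (hsingle : A = {x} → R.rowTo y A = ∅)
    (hXrow : ∀ w, Disjoint X (R.row w)) (hX : X ⊆ G.edgesOf A) (hcost : G.contractionCost A B ≤ L)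
    (hform : G.IsFormedWithin A L) :
    (∏ e ∈ X, (G.dim e : ℝ)) * (κ ^ 2 * ∏ e ∈ R.rowTo y A, (G.dim e : ℝ)) ≤ L := by
  rcases hform with ⟨w, rfl⟩ | ⟨A₁, A₂, h₁, h₂, hd, hA, hL⟩
  · rw [hsingle (congrArg _ (Finset.mem_singleton.mp hx.1).symm), Finset.prod_empty, mul_one]
    exact (prod_mul_sq_le_contractionCost hκ hAB hx hy (hX.trans Finset.subset_union_left)
      (hXrow x) (hXrow y)).trans hcost
  · have hyA : y ∉ A := fun h => Finset.disjoint_left.mp hAB h hy.1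
    exact (prod_mul_rowTo_le_contractionCost hκ hx hyA hXrow hX h₁ h₂ hd hA).trans hL

lemma exists_prod_mul_le_of_isConsumedWithin [DecidableEq W] (hκ : 0 ≤ κ) (hAB : Disjoint A B)
    (hx : R.IsLast x A) (hy : R.IsLast y B) (hyx : R.ord y ≤ R.ord x)
    (hXrow : ∀ w, Disjoint X (R.row w)) (hX : X ⊆ G.edgesOf (A ∪ B))
    (hcost : G.contractionCost A B ≤ L) (hcons : G.IsConsumedWithin (A ∪ B) L) :
    ∃ u : ℝ, 0 ≤ u ∧ κ ≤ (∏ e ∈ R.rowTo y A, (G.dim e : ℝ)) * u ∧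
      (∏ e ∈ X, (G.dim e : ℝ)) * (κ ^ 2 * u) ≤ L := by
  rcases hcons with huniv | ⟨C, hC, hd, hL⟩
  · refine ⟨1, zero_le_one, ?_, ?_⟩
    · simpa using le_prod_rowTo_of_univ hAB hx hy hyx huniv
    · rw [mul_one]
      exact (prod_mul_sq_le_contractionCost hκ hAB hx hy (hX.trans (G.edgesOf_union_subset A B))
        (hXrow x) (hXrow y)).trans hcost
  · exact ⟨_, G.prod_dim_nonneg _, R.le_rowTo_mul_rowAway y A,
      (prod_mul_rowAway_le_contractionCost hκ hAB hx hy hyx hXrow hX hC hd).trans hL⟩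

/-- The row of `y` splits into the edges to `A`, which are present when `A` is formed, and the other
ones, which are present when `A ∪ B` is consumed. Either contraction also involves two whole rows,
so that the product of the two costs sees five factors `κ`. -/
lemma prod_mul_prod_mul_pow_five_le [DecidableEq W] (hκ : 0 ≤ κ) (hAB : Disjoint A B)
    (hx : R.IsLast x A) (hy : R.IsLast y B) (hyx : R.ord y ≤ R.ord x)
    (hsingle : A = {x} → R.rowTo y A = ∅) (hXrow : ∀ w, Disjoint X (R.row w))
    (hX : X ⊆ G.edgesOf A) (hYrow : ∀ w, Disjoint Y (R.row w)) (hY : Y ⊆ G.edgesOf (A ∪ B))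
    (hcost : G.contractionCost A B ≤ L) (hform : G.IsFormedWithin A L)
    (hcons : G.IsConsumedWithin (A ∪ B) L) :
    (∏ e ∈ X, (G.dim e : ℝ)) * (∏ e ∈ Y, (G.dim e : ℝ)) * κ ^ 5 ≤ L ^ 2 := by
  obtain ⟨u, hu, hκu, hconsumed⟩ :=
    exists_prod_mul_le_of_isConsumedWithin hκ hAB hx hy hyx hYrow hY hcost hcons
  have hformed := prod_mul_rowTo_le hκ hAB hx hy hsingle hXrow hX hcost hform
  have := G.prod_dim_nonneg X
  have := G.prod_dim_nonneg Y
  have hL : 0 ≤ L := (G.contractionCost_pos A B).le.trans hcost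
  set t := ∏ e ∈ R.rowTo y A, (G.dim e : ℝ)
  calc (∏ e ∈ X, (G.dim e : ℝ)) * (∏ e ∈ Y, (G.dim e : ℝ)) * κ ^ 5
      = (∏ e ∈ X, (G.dim e : ℝ)) * (∏ e ∈ Y, (G.dim e : ℝ)) * κ ^ 4 * κ := by ring
    _ ≤ (∏ e ∈ X, (G.dim e : ℝ)) * (∏ e ∈ Y, (G.dim e : ℝ)) * κ ^ 4 * (t * u) := by gcongr
    _ = ((∏ e ∈ X, (G.dim e : ℝ)) * (κ ^ 2 * t)) * ((∏ e ∈ Y, (G.dim e : ℝ)) * (κ ^ 2 * u)) := by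
        ring
    _ ≤ L * L := mul_le_mul hformed hconsumed (by positivity) hL
    _ = L ^ 2 := (sq L).symm

end RowSystem

end TensorNetwork

/-! ### The sizes of a data contraction -/

namespace ContractionTree

variable {V VE : Type*}

lemma mem_dataPart {A : Finset (V ⊕ VE)} {v : V} : v ∈ dataPart A ↔ Sum.inl v ∈ A := by
  simp [dataPart]

lemma dataPart_union [DecidableEq V] [DecidableEq (V ⊕ VE)] (A B : Finset (V ⊕ VE)) :
    dataPart (A ∪ B) = dataPart A ∪ dataPart B := by
  ext v
  simp [mem_dataPart]

lemma disjoint_dataPart {A B : Finset (V ⊕ VE)} (h : Disjoint A B) :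
    Disjoint (dataPart A) (dataPart B) := by
  rw [Finset.disjoint_left] at h ⊢
  exact fun v hv hw => h (mem_dataPart.mp hv) (mem_dataPart.mp hw)

lemma dataPart_singleton_inl (v : V) : dataPart ({.inl v} : Finset (V ⊕ VE)) = {v} := by
  ext w
  simp [mem_dataPart]

lemma dataPart_singleton_inr (z : VE) : dataPart ({.inr z} : Finset (V ⊕ VE)) = ∅ := by
  ext w
  simp [mem_dataPart]

lemma ConstrainedOn.exists_injective {T : ContractionTree (V ⊕ VE)} {T₀ : ContractionTree V}
    (hcon : T.ConstrainedOn T₀) (hT₀ : T₀.leaves.Nodup) :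
    ∃ n : T₀.Contraction → T.Contraction, Function.Injective n ∧
      ∀ i, s(dataPart (T.leftVerts (n i)), dataPart (T.rightVerts (n i))) =
        s(T₀.leftVerts i, T₀.rightVerts i) := by
  have hex (i : T₀.Contraction) : ∃ j : T.Contraction,
      s(dataPart (T.leftVerts j), dataPart (T.rightVerts j)) =
        s(T₀.leftVerts i, T₀.rightVerts i) := by
    obtain ⟨q, hq, h⟩ := hcon _ (mem_contractions_iff.mpr ⟨i, rfl⟩)
    obtain ⟨j, rfl⟩ := mem_contractions_iff.mp hq
    exact ⟨j, Sym2.eq_iff.mpr h⟩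
  choose n hn using hex
  refine ⟨n, fun i j hij => T₀.leftVerts_union_rightVerts_injective hT₀ ?_, hn⟩
  have hs := (hn i).symm.trans ((congrArg
    (fun k => s(dataPart (T.leftVerts k), dataPart (T.rightVerts k))) hij).trans (hn j))
  rcases Sym2.eq_iff.mp hs with ⟨hl, hr⟩ | ⟨hl, hr⟩
  · exact congrArg₂ _ hl hr
  · exact (congrArg₂ _ hl hr).trans (Finset.union_comm _ _)

end ContractionTree

namespace DataNetwork

section Sizes

variable {V E S : Type*} [Fintype E] (D : DataNetwork V E S) {A B : Finset V}

lemma outerSize_pos (A B : Finset V) : 0 < D.outerSize A B := Real.exp_pos _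

lemma sharedSize_pos (A B : Finset V) : 0 < D.sharedSize A B :=
  div_pos (Real.exp_pos _) (mul_pos (D.outerSize_pos A B) (D.outerSize_pos B A))

lemma exp_cutBetween (A B : Finset V) :
    Real.exp (D.rest.cutBetween A B) = D.contractedSize A B * D.sharedSize A B := by
  rw [contractedSize, div_mul_cancel₀ _ (D.sharedSize_pos A B).ne']

lemma exp_cut_left (A B : Finset V) : Real.exp (D.rest.cut A) =
    D.outerSize A B * D.contractedSize A B * D.sharedSize A B := by
  rw [mul_assoc, ← exp_cutBetween, outerSize, ← Real.exp_add, sub_add_cancel]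

lemma exp_cut_union (A B : Finset V) : Real.exp (D.rest.cut (A ∪ B)) =
    D.outerSize A B * D.outerSize B A * D.sharedSize A B := by
  have := D.outerSize_pos A B
  have := D.outerSize_pos B A
  rw [sharedSize]
  field_simp

lemma contractionCost_rest (A B : Finset V) : D.rest.contractionCost A B =
    D.outerSize A B * D.outerSize B A * D.contractedSize A B * D.sharedSize A B := by
  rw [mul_assoc, ← exp_cutBetween, outerSize, outerSize, D.rest.cutBetween_comm B A,
    ← Real.exp_add, ← Real.exp_add, TensorNetwork.contractionCost]
  congr 1
  ring

lemma one_le_outerSize (h : Disjoint A B) : 1 ≤ D.outerSize A B := by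
  rw [outerSize, Real.one_le_exp_iff, sub_nonneg, ← Real.exp_le_exp, D.rest.exp_cut,
    TensorNetwork.cutBetween, D.rest.exp_sum_weight, D.rest.edgesBetween_eq_inter h]
  exact D.rest.prod_dim_mono Finset.inter_subset_left

lemma one_le_contractedSize (h : Disjoint A B) : 1 ≤ D.contractedSize A B := by
  have hle : Real.exp (D.rest.cut (A ∪ B)) ≤ D.rest.contractionCost A B := by
    rw [D.rest.exp_cut]
    exact D.rest.prod_le_contractionCost h (D.rest.edgesOf_union_subset A B)
  rw [exp_cut_union, contractionCost_rest, mul_right_comm _ (D.contractedSize A B)] at hle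
  exact (le_mul_iff_one_le_right (mul_pos (mul_pos (D.outerSize_pos A B)
    (D.outerSize_pos B A)) (D.sharedSize_pos A B))).mp hle

lemma cut_le_cut_iff (A B : Finset V) :
    D.rest.cut A ≤ D.rest.cut B ↔ D.outerSize A B ≤ D.outerSize B A := by
  rw [outerSize, outerSize, Real.exp_le_exp, D.rest.cutBetween_comm B A, sub_le_sub_iff_right]

end Sizes

section StageCost

variable {V E S : Type*} [Fintype E] (D : DataNetwork V E S) {A B : Finset V} {m : ℕ}

/-- The split `α = √(m c / b)` of the sketch dimension of `B` before it is rounded and cut off. -/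
noncomputable def idealSplit (m : ℕ) (A B : Finset V) : ℝ :=
  Real.sqrt (m * D.outerSize B A / D.contractedSize A B)

/-- The cost of the three contractions of the algorithm, up to a factor of two in the last one, for
the data contraction of `A` and `B`, where `A` is sketched first. -/
noncomputable def stageCost (m : ℕ) (A B : Finset V) : ℝ :=
  D.outerSize A B * D.contractedSize A B * D.sharedSize A B * (m * D.splitSize m A B * m) +
  D.rest.contractionCost A B * (D.splitSize m A B * D.cosplitSize m A B * m) +
  D.outerSize A B * D.outerSize B A * D.sharedSize A B * (D.cosplitSize m A B * m * (2 * m))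

lemma cosplitSize_le (hm : 0 < m) (A B : Finset V) :
    (D.cosplitSize m A B : ℝ) ≤ 2 * (m * (D.splitSize m A B : ℝ)⁻¹) := by
  have hα : (0 : ℝ) < D.splitSize m A B := Nat.cast_pos.mpr (D.splitSize_pos hm A B)
  have hαm : (D.splitSize m A B : ℝ) ≤ m := Nat.cast_le.mpr (min_le_left _ _)
  have hone : 1 ≤ (m : ℝ) / D.splitSize m A B := (one_le_div hα).mpr hαm
  have hceil : (D.cosplitSize m A B : ℝ) < m / D.splitSize m A B + 1 :=
    Nat.ceil_lt_add_one (zero_le_one.trans hone)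
  rw [← div_eq_mul_inv]
  linarith

lemma splitSize_mul_cosplitSize_le (hm : 0 < m) (A B : Finset V) :
    (D.splitSize m A B * D.cosplitSize m A B : ℝ) ≤ 2 * m := by
  have hα : (0 : ℝ) < D.splitSize m A B := Nat.cast_pos.mpr (D.splitSize_pos hm A B)
  calc (D.splitSize m A B * D.cosplitSize m A B : ℝ)
      ≤ D.splitSize m A B * (2 * (m * (D.splitSize m A B : ℝ)⁻¹)) := by
        gcongr
        exact D.cosplitSize_le hm A B
    _ = 2 * m := by field_simp

lemma le_splitSize_mul_cosplitSize (hm : 0 < m) (A B : Finset V) :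
    m ≤ D.splitSize m A B * D.cosplitSize m A B := by
  have hα : (0 : ℝ) < D.splitSize m A B := Nat.cast_pos.mpr (D.splitSize_pos hm A B)
  have h : (m / D.splitSize m A B : ℝ) ≤ D.cosplitSize m A B := Nat.le_ceil _
  rw [div_le_iff₀' hα] at h
  exact_mod_cast h

lemma idealSplit_pos (hm : 0 < m) (hAB : Disjoint A B) : 0 < D.idealSplit m A B :=
  Real.sqrt_pos.mpr (div_pos (mul_pos (Nat.cast_pos.mpr hm) (D.outerSize_pos B A))
    (zero_lt_one.trans_le (D.one_le_contractedSize hAB)))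

lemma splitSize_le_idealSplit_add_one (m : ℕ) (A B : Finset V) :
    (D.splitSize m A B : ℝ) ≤ D.idealSplit m A B + 1 :=
  (Nat.cast_le.mpr (min_le_right _ _)).trans (Nat.ceil_lt_add_one (Real.sqrt_nonneg _)).le

lemma inv_splitSize_le (hm : 0 < m) (hAB : Disjoint A B) :
    (D.splitSize m A B : ℝ)⁻¹ ≤ (m : ℝ)⁻¹ + (D.idealSplit m A B)⁻¹ := by
  have hρ := D.idealSplit_pos hm hAB
  have hceil : D.idealSplit m A B ≤ ⌈D.idealSplit m A B⌉₊ := Nat.le_ceil _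
  rcases min_choice m ⌈D.idealSplit m A B⌉₊ with h | h
  · rw [show D.splitSize m A B = m from h]
    exact le_add_of_nonneg_right (inv_nonneg.mpr hρ.le)
  · rw [show D.splitSize m A B = ⌈D.idealSplit m A B⌉₊ from h]
    exact (inv_anti₀ hρ hceil).trans (le_add_of_nonneg_left (by positivity))

lemma contractedSize_mul_idealSplit_sq (m : ℕ) (hAB : Disjoint A B) :
    D.contractedSize A B * D.idealSplit m A B ^ 2 = m * D.outerSize B A := by
  have hb := zero_lt_one.trans_le (D.one_le_contractedSize hAB)
  have hq := D.outerSize_pos B A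
  rw [idealSplit, Real.sq_sqrt (by positivity)]
  field_simp

/-- `α` balances the first and the third term of the cost. -/
lemma stageCost_le (hm : 0 < m) (hAB : Disjoint A B) :
    D.stageCost m A B ≤ 7 * (D.rest.contractionCost A B * m ^ 2) +
      5 * (Real.exp (D.rest.cut A) * m ^ 2 * D.idealSplit m A B) := by
  have : (0 : ℝ) < m := Nat.cast_pos.mpr hm
  have hp := D.outerSize_pos A B
  have hq := D.one_le_outerSize hAB.symm
  have hb := D.one_le_contractedSize hAB
  have hd := D.sharedSize_pos A B
  have hρ := D.idealSplit_pos hm hAB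
  have hsq := D.contractedSize_mul_idealSplit_sq m hAB
  have hsplit := D.splitSize_le_idealSplit_add_one m A B
  have hprod := D.splitSize_mul_cosplitSize_le hm A B
  have hcosplit : (D.cosplitSize m A B : ℝ) ≤ 2 * (m * ((m : ℝ)⁻¹ + (D.idealSplit m A B)⁻¹)) :=
    (D.cosplitSize_le hm A B).trans (by gcongr; exact D.inv_splitSize_le hm hAB)
  rw [stageCost, D.contractionCost_rest, D.exp_cut_left A B]
  set p := D.outerSize A B
  set q := D.outerSize B A
  set b := D.contractedSize A B
  set d := D.sharedSize A B
  set ρ := D.idealSplit m A B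
  set α := (D.splitSize m A B : ℝ)
  set β := (D.cosplitSize m A B : ℝ)
  have first : p * b * d * (m * α * m) ≤ p * q * b * d * m ^ 2 + p * b * d * m ^ 2 * ρ := calc
    p * b * d * (m * α * m) ≤ p * b * d * (m * (ρ + 1) * m) := by gcongr
    _ = p * 1 * b * d * m ^ 2 + p * b * d * m ^ 2 * ρ := by ring
    _ ≤ p * q * b * d * m ^ 2 + p * b * d * m ^ 2 * ρ := by gcongr
  have second : p * q * b * d * (α * β * m) ≤ 2 * (p * q * b * d * m ^ 2) := calc
    p * q * b * d * (α * β * m) ≤ p * q * b * d * (2 * m * m) := by gcongr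
    _ = 2 * (p * q * b * d * m ^ 2) := by ring
  have third : p * q * d * (β * m * (2 * m)) ≤
      4 * (p * q * b * d * m ^ 2) + 4 * (p * b * d * m ^ 2 * ρ) := calc
    p * q * d * (β * m * (2 * m))
      ≤ p * q * d * (2 * (m * ((m : ℝ)⁻¹ + ρ⁻¹)) * m * (2 * m)) := by gcongr
    _ = 4 * (p * q * 1 * d * m ^ 2) + 4 * (p * d * m ^ 2 * (m * q) * ρ⁻¹) := by
      field_simp
      ring
    _ = 4 * (p * q * 1 * d * m ^ 2) + 4 * (p * b * d * m ^ 2 * ρ) := by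
      rw [← hsq]
      field_simp
    _ ≤ 4 * (p * q * b * d * m ^ 2) + 4 * (p * b * d * m ^ 2 * ρ) := by gcongr
  linarith

lemma exp_cut_mul_idealSplit_sq (m : ℕ) (hAB : Disjoint A B) :
    (Real.exp (D.rest.cut A) * m ^ 2 * D.idealSplit m A B) ^ 2 =
      Real.exp (D.rest.cut A) * Real.exp (D.rest.cut (A ∪ B)) * m ^ 5 := by
  rw [mul_pow, D.exp_cut_left A B, D.exp_cut_union]
  linear_combination (D.outerSize A B * D.sharedSize A B) ^ 2 * D.contractedSize A B * m ^ 4 *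
    D.contractedSize_mul_idealSplit_sq m hAB

lemma pow_three_mul_stageCost_le (hm : 0 < m) (hAB : Disjoint A B) {k L : ℝ} (hk : 0 ≤ k)
    (hk1 : k ≤ 1) (hL : 0 ≤ L) (hcost : D.rest.contractionCost A B * (k * m) ^ 2 ≤ L)
    (hcut : Real.exp (D.rest.cut A) * Real.exp (D.rest.cut (A ∪ B)) * (k * m) ^ 5 ≤ L ^ 2) :
    k ^ 3 * D.stageCost m A B ≤ 12 * L := by
  have hstage := D.stageCost_le hm hAB
  have hsq := D.exp_cut_mul_idealSplit_sq m hAB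
  have hX0 : 0 ≤ D.rest.contractionCost A B * m ^ 2 :=
    mul_nonneg (D.rest.contractionCost_pos A B).le (by positivity)
  set X := D.rest.contractionCost A B * m ^ 2 with hX
  set Y := Real.exp (D.rest.cut A) * m ^ 2 * D.idealSplit m A B
  have hXL : k ^ 3 * X ≤ L := calc
    k ^ 3 * X ≤ k ^ 2 * X := mul_le_mul_of_nonneg_right (pow_le_pow_of_le_one hk hk1 (by simp)) hX0
    _ = D.rest.contractionCost A B * (k * m) ^ 2 := by rw [hX]; ring
    _ ≤ L := hcost
  have hYL : k ^ 3 * Y ≤ L := by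
    refine le_of_sq_le_sq ?_ hL
    calc (k ^ 3 * Y) ^ 2 = k ^ 6 * Y ^ 2 := by ring
      _ ≤ k ^ 5 * Y ^ 2 :=
        mul_le_mul_of_nonneg_right (pow_le_pow_of_le_one hk hk1 (by simp)) (sq_nonneg Y)
      _ = Real.exp (D.rest.cut A) * Real.exp (D.rest.cut (A ∪ B)) * (k * m) ^ 5 := by
        rw [hsq]; ring
      _ ≤ L ^ 2 := hcut
  calc k ^ 3 * D.stageCost m A B ≤ k ^ 3 * (7 * X + 5 * Y) := by gcongr
    _ = 7 * (k ^ 3 * X) + 5 * (k ^ 3 * Y) := by ring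
    _ ≤ 12 * L := by linarith

end StageCost

end DataNetwork

/-! ### The lower bound -/

namespace Embedding

variable {S VE EE : Type*} [Fintype EE] (F : Embedding S VE EE) {ord : VE → ℕ} {v w : VE}

/-- The edges that carry the row dimensions of the tensor at `v`, whose product is `rowSize`. -/
noncomputable def row (ord : VE → ℕ) (v : VE) : Finset EE :=
  Finset.univ.filter fun f => v ∈ F.ends f ∧ ((F.ends f).card = 1 ∨ ∃ u ∈ F.ends f, ord v < ord u)

lemma mem_row {f : EE} : f ∈ F.row ord v ↔
    v ∈ F.ends f ∧ ((F.ends f).card = 1 ∨ ∃ u ∈ F.ends f, ord v < ord u) := by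
  simp [row]

lemma prod_row (ord : VE → ℕ) (v : VE) : ∏ f ∈ F.row ord v, F.dim f = F.rowSize ord v := rfl

lemma prod_le_rowSize {Y : Finset EE} (hY : Y ⊆ F.row ord v) :
    ∏ f ∈ Y, F.dim f ≤ F.rowSize ord v :=
  Finset.prod_le_prod_of_subset_of_one_le' hY fun f _ _ => F.dim_pos f

lemma disjoint_row (hvw : v ≠ w) : Disjoint (F.row ord v) (F.row ord w) := by
  rw [Finset.disjoint_left]
  intro f hf hf'
  obtain ⟨hv, hv'⟩ := F.mem_row.mp hf
  obtain ⟨hw, hw'⟩ := F.mem_row.mp hf'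
  have hcard : (F.ends f).card ≠ 1 := fun h => hvw (Finset.card_le_one.mp h.le v hv w hw)
  have hends : {v, w} = F.ends f := by
    refine Finset.eq_of_subset_of_card_le (by simp [Finset.insert_subset_iff, hv, hw]) ?_
    rw [Finset.card_pair hvw]
    exact ((F.ends_card f).resolve_left hcard).le
  have hvlt : ord v < ord w := by simpa [← hends] using hv'.resolve_left hcard
  have hwlt : ord w < ord v := by simpa [← hends] using hw'.resolve_left hcard
  exact hvlt.not_gt hwlt

end Embedding

namespace Alg

open ContractionTree

variable {V E S : Type*} [Fintype E] (D : DataNetwork V E S) {T : ContractionTree V}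
  (i : T.Contraction)

lemma sym2_firstVerts_secondVerts :
    s(firstVerts D T i, secondVerts D T i) = s(T.leftVerts i, T.rightVerts i) := by
  unfold firstVerts secondVerts
  split_ifs
  · rfl
  · exact Sym2.eq_swap

lemma firstVerts_nonempty : (firstVerts D T i).Nonempty := by
  unfold firstVerts
  split_ifs
  exacts [T.leftVerts_nonempty i, T.rightVerts_nonempty i]

lemma secondVerts_nonempty : (secondVerts D T i).Nonempty := by
  unfold secondVerts
  split_ifs
  exacts [T.rightVerts_nonempty i, T.leftVerts_nonempty i]

lemma outerSize_firstVerts_le : D.outerSize (firstVerts D T i) (secondVerts D T i) ≤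
    D.outerSize (secondVerts D T i) (firstVerts D T i) := by
  unfold firstVerts secondVerts
  split_ifs with h
  exacts [h, le_of_not_ge h]

end Alg

namespace DataNetwork

open ContractionTree

variable {V E S VE EE : Type*} (D : DataNetwork V E S) (F : Embedding S VE EE)

section DataEdges

/-- Edges of the data network as edges of the overall network. -/
def dataEdges (S EE : Type*) (X : Finset E) : Finset (E ⊕ S ⊕ EE) :=
  X.map Function.Embedding.inl

lemma prod_dataEdges (X : Finset E) :
    ∏ e ∈ dataEdges S EE X, ((D.withEmbedding F).dim e : ℝ) = ∏ e ∈ X, (D.rest.dim e : ℝ) := by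
  rw [dataEdges, Finset.prod_map]
  rfl

variable [Fintype E]

lemma exp_cut_eq_prod_dataEdges (A : Finset V) : Real.exp (D.rest.cut A) =
    ∏ e ∈ dataEdges S EE (D.rest.edgesOf A), ((D.withEmbedding F).dim e : ℝ) := by
  rw [prod_dataEdges, D.rest.exp_cut]

variable [Fintype S] [Fintype EE]

lemma inl_mem_edgesOf {A : Finset (V ⊕ VE)} {e : E} :
    Sum.inl e ∈ (D.withEmbedding F).edgesOf A ↔ e ∈ D.rest.edgesOf (dataPart A) := by
  simp [TensorNetwork.mem_edgesOf, withEmbedding, mem_dataPart]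

lemma dataEdges_subset_edgesOf (A : Finset (V ⊕ VE)) :
    dataEdges S EE (D.rest.edgesOf (dataPart A)) ⊆ (D.withEmbedding F).edgesOf A := by
  intro e he
  obtain ⟨f, hf, rfl⟩ := Finset.mem_map.mp he
  exact (D.inl_mem_edgesOf F).mpr hf

end DataEdges

variable [Fintype EE] (hD : Function.Surjective D.vertex) (ord : VE → ℕ) {κ : ℝ}

lemma vertex_edgeAt (v : V) : D.vertex (Alg.edgeAt D hD v) = v := Function.surjInv_eq hD v

/-- The row of a data tensor is its edge to be sketched, and the row of an embedding tensor is its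
row in the embedding. -/
noncomputable def overallRow : V ⊕ VE → Finset (E ⊕ S ⊕ EE) :=
  Sum.elim (fun v => {.inr (.inl (Alg.edgeAt D hD v))})
    fun v => (F.row ord v).map (Function.Embedding.inr.trans Function.Embedding.inr)

/-- An ordering in which the data tensors precede the embedding tensors. -/
def overallOrd : V ⊕ VE → ℕ := Sum.elim (fun _ => 0) fun v => ord v + 1

variable {ord}

lemma mem_ends_of_mem_overallRow {x : V ⊕ VE} {e : E ⊕ S ⊕ EE}
    (he : e ∈ D.overallRow F hD ord x) : x ∈ (D.withEmbedding F).ends e := by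
  rcases x with v | v
  · obtain rfl := Finset.mem_singleton.mp he
    simp [withEmbedding, D.vertex_edgeAt hD]
  · obtain ⟨f, hf, rfl⟩ := Finset.mem_map.mp he
    simpa [withEmbedding] using (F.mem_row.mp hf).1

lemma exits_of_mem_overallRow {x : V ⊕ VE} {e : E ⊕ S ⊕ EE} (he : e ∈ D.overallRow F hD ord x) :
    (D.withEmbedding F).dangling e ∨
      ∃ y ∈ (D.withEmbedding F).ends e, overallOrd ord x < overallOrd ord y := by
  rcases x with v | v
  · obtain rfl := Finset.mem_singleton.mp he
    exact .inr ⟨.inr (F.input (Alg.edgeAt D hD v)), by simp [withEmbedding], Nat.succ_pos _⟩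
  · obtain ⟨f, hf, rfl⟩ := Finset.mem_map.mp he
    exact (F.mem_row.mp hf).2.imp_right fun ⟨u, hu, hlt⟩ =>
      ⟨.inr u, by simpa [withEmbedding] using hu, Nat.succ_lt_succ hlt⟩

lemma disjoint_overallRow {x y : V ⊕ VE} (hxy : x ≠ y) :
    Disjoint (D.overallRow F hD ord x) (D.overallRow F hD ord y) := by
  rcases x with v | v <;> rcases y with w | w
  · have hne : Alg.edgeAt D hD v ≠ Alg.edgeAt D hD w := fun h =>
      hxy (congrArg _ (Function.injective_surjInv hD h))
    simpa [overallRow] using hne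
  · simp [overallRow]
  · simp [overallRow]
  · exact (Finset.disjoint_map _).mpr (F.disjoint_row fun h => hxy (congrArg _ h))

lemma disjoint_dataEdges_overallRow (X : Finset E) (w : V ⊕ VE) :
    Disjoint (dataEdges S EE X) (D.overallRow F hD ord w) := by
  rw [Finset.disjoint_left]
  intro e he hw
  obtain ⟨f, -, rfl⟩ := Finset.mem_map.mp he
  rcases w with w | w <;> simp [overallRow] at hw

lemma exists_output_of_dangling {x : V ⊕ VE} {e : E ⊕ S ⊕ EE}
    (he : e ∈ D.overallRow F hD ord x) (hdang : (D.withEmbedding F).dangling e) :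
    ∃ f ∈ F.outputs, e = .inr (.inr f) := by
  rcases x with v | v
  · obtain rfl := Finset.mem_singleton.mp he
    exact hdang.elim
  · obtain ⟨f, -, rfl⟩ := Finset.mem_map.mp he
    exact ⟨f, Finset.mem_filter.mpr ⟨Finset.mem_univ f, hdang⟩, rfl⟩

/-- The edges to be sketched and, for the ordering `ord`, the rows of the embedding have size at
least `κ`, and the embedding has only one output edge. -/
structure HasLargeRows (ord : VE → ℕ) (κ : ℝ) : Prop where
  le_size : ∀ s, κ ≤ D.size s
  le_rowSize : ∀ v, κ ≤ F.rowSize ord v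
  one_output : F.outputs.card = 1

namespace HasLargeRows

variable {D F} (h : D.HasLargeRows F ord κ)

lemma le_prod_overallRow (h : D.HasLargeRows F ord κ) (x : V ⊕ VE) :
    κ ≤ ∏ e ∈ D.overallRow F hD ord x, ((D.withEmbedding F).dim e : ℝ) := by
  rcases x with v | v
  · simpa [overallRow, withEmbedding] using h.le_size _
  · refine (h.le_rowSize v).trans_eq ?_
    rw [← F.prod_row, Nat.cast_prod, overallRow, Sum.elim_inr, Finset.prod_map]
    rfl

/-- The row system of the overall network. -/
noncomputable def rowSystem : (D.withEmbedding F).RowSystem κ where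
  ord := overallOrd ord
  row := D.overallRow F hD ord
  mem_ends _ _ := D.mem_ends_of_mem_overallRow F hD
  exits _ _ := D.exits_of_mem_overallRow F hD
  disjoint_row _ _ := D.disjoint_overallRow F hD
  le_prod := h.le_prod_overallRow hD
  dangling_unique x y e he f hf hed hfd := by
    obtain ⟨e', he', rfl⟩ := D.exists_output_of_dangling F hD he hed
    obtain ⟨f', hf', rfl⟩ := D.exists_output_of_dangling F hD hf hfd
    rw [Finset.card_le_one.mp h.one_output.le e' he' f' hf']

lemma rowTo_singleton {x y : V ⊕ VE} (hxy : x ≠ y) {v : V} (hx : x = .inl v)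
    (hyx : (h.rowSystem hD).ord y ≤ (h.rowSystem hD).ord x) :
    (h.rowSystem hD).rowTo y {x} = ∅ := by
  subst hx
  rcases y with w | w
  · refine Finset.eq_empty_of_forall_notMem fun e he => hxy ?_
    obtain ⟨hrow, u, hu, hux⟩ := ((h.rowSystem hD).mem_rowTo).mp he
    obtain rfl := Finset.mem_singleton.mp hrow
    obtain rfl := Finset.mem_singleton.mp hux
    simpa [withEmbedding, D.vertex_edgeAt hD] using hu
  · exact absurd hyx (Nat.not_succ_le_zero _)

variable [Fintype E] [Fintype S] {A B : Finset (V ⊕ VE)} {x y : V ⊕ VE} {L : ℝ}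

include hD in
lemma contractionCost_dataPart_mul_sq_le (h : D.HasLargeRows F ord κ) (hκ : 0 ≤ κ)
    (hAB : Disjoint A B) (hA : A.Nonempty) (hB : B.Nonempty) :
    D.rest.contractionCost (dataPart A) (dataPart B) * κ ^ 2 ≤
      (D.withEmbedding F).contractionCost A B := by
  obtain ⟨x, hx⟩ := (h.rowSystem hD).exists_isLast hA
  obtain ⟨y, hy⟩ := (h.rowSystem hD).exists_isLast hB
  rw [D.rest.contractionCost_eq_prod (disjoint_dataPart hAB), ← D.prod_dataEdges F]
  refine TensorNetwork.RowSystem.prod_mul_sq_le_contractionCost hκ hAB hx hy ?_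
    (D.disjoint_dataEdges_overallRow F hD _ _) (D.disjoint_dataEdges_overallRow F hD _ _)
  rw [dataEdges, Finset.map_union]
  exact Finset.union_subset_union (D.dataEdges_subset_edgesOf F A)
    (D.dataEdges_subset_edgesOf F B)

lemma exp_cut_mul_exp_cut_mul_pow_five_le (hκ : 0 ≤ κ) (hAB : Disjoint A B)
    (hx : (h.rowSystem hD).IsLast x A) (hy : (h.rowSystem hD).IsLast y B)
    (hyx : (h.rowSystem hD).ord y ≤ (h.rowSystem hD).ord x) (hA : (dataPart A).Nonempty)
    (hcost : (D.withEmbedding F).contractionCost A B ≤ L)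
    (hform : (D.withEmbedding F).IsFormedWithin A L)
    (hcons : (D.withEmbedding F).IsConsumedWithin (A ∪ B) L) :
    Real.exp (D.rest.cut (dataPart A)) * Real.exp (D.rest.cut (dataPart A ∪ dataPart B)) * κ ^ 5 ≤
      L ^ 2 := by
  rw [← dataPart_union, D.exp_cut_eq_prod_dataEdges F, D.exp_cut_eq_prod_dataEdges F]
  refine TensorNetwork.RowSystem.prod_mul_prod_mul_pow_five_le hκ hAB hx hy hyx ?_
    (D.disjoint_dataEdges_overallRow F hD _) (D.dataEdges_subset_edgesOf F A)
    (D.disjoint_dataEdges_overallRow F hD _) (D.dataEdges_subset_edgesOf F (A ∪ B))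
    hcost hform hcons
  rintro rfl
  obtain ⟨v, hv⟩ := hA
  have hvx : Sum.inl v = x := Finset.mem_singleton.mp (mem_dataPart.mp hv)
  exact h.rowTo_singleton hD (fun hxy => Finset.disjoint_left.mp hAB hx.1 (hxy ▸ hy.1)) hvx.symm hyx

include hD in
lemma min_exp_cut_mul_exp_cut_mul_pow_five_le (h : D.HasLargeRows F ord κ) (hκ : 0 ≤ κ)
    (hAB : Disjoint A B) (hA : (dataPart A).Nonempty) (hB : (dataPart B).Nonempty)
    (hcost : (D.withEmbedding F).contractionCost A B ≤ L)
    (hform : (D.withEmbedding F).IsFormedWithin A L)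
    (hform' : (D.withEmbedding F).IsFormedWithin B L)
    (hcons : (D.withEmbedding F).IsConsumedWithin (A ∪ B) L) :
    min (Real.exp (D.rest.cut (dataPart A))) (Real.exp (D.rest.cut (dataPart B))) *
      Real.exp (D.rest.cut (dataPart A ∪ dataPart B)) * κ ^ 5 ≤ L ^ 2 := by
  obtain ⟨v, hv⟩ := hA
  obtain ⟨w, hw⟩ := hB
  obtain ⟨x, hx⟩ := (h.rowSystem hD).exists_isLast ⟨_, mem_dataPart.mp hv⟩
  obtain ⟨y, hy⟩ := (h.rowSystem hD).exists_isLast ⟨_, mem_dataPart.mp hw⟩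
  rcases le_total ((h.rowSystem hD).ord y) ((h.rowSystem hD).ord x) with hyx | hxy
  · refine le_trans ?_
      (h.exp_cut_mul_exp_cut_mul_pow_five_le hD hκ hAB hx hy hyx ⟨v, hv⟩ hcost hform hcons)
    gcongr
    exact min_le_left _ _
  · rw [TensorNetwork.contractionCost_comm] at hcost
    rw [Finset.union_comm] at hcons ⊢
    refine le_trans ?_
      (h.exp_cut_mul_exp_cut_mul_pow_five_le hD hκ hAB.symm hy hx hxy ⟨w, hw⟩ hcost hform' hcons)
    gcongr
    exact min_le_right _ _

variable {k : ℝ} {m : ℕ} {T : ContractionTree (V ⊕ VE)}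

include hD in
lemma pow_three_mul_stageCost_le_neighborCost (h : D.HasLargeRows F ord (k * m)) (hm : 0 < m)
    (hk : 0 ≤ k) (hk1 : k ≤ 1) (hT : T.IsFull) (i : T.Contraction) {A B : Finset V}
    (hAB : s(dataPart (T.leftVerts i), dataPart (T.rightVerts i)) = s(A, B)) (hA : A.Nonempty)
    (hB : B.Nonempty) (hle : D.outerSize A B ≤ D.outerSize B A) :
    k ^ 3 * D.stageCost m A B ≤ 12 * neighborCost (D.withEmbedding F) 0 T i := by
  have hκ : 0 ≤ k * m := by positivity
  have hd := T.disjoint_leftVerts_rightVerts hT.1 i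
  have hcost := T.contractionCost_le_neighborCost (D.withEmbedding F) le_rfl i
  obtain ⟨hform, hform'⟩ := T.isFormedWithin_operands (D.withEmbedding F) hT.1 le_rfl i
  have hcons := T.isConsumedWithin_result (D.withEmbedding F) hT.1 le_rfl
    (.inl fun w => mem_verts.mpr (hT.2 w)) i
  have hsq := (h.contractionCost_dataPart_mul_sq_le hD hκ hd (T.leftVerts_nonempty i)
    (T.rightVerts_nonempty i)).trans hcost
  have hcut := Real.exp_le_exp.mpr ((D.cut_le_cut_iff A B).mpr hle)
  have hL := (T.neighborCost_pos (D.withEmbedding F) le_rfl i).le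
  rcases Sym2.eq_iff.mp hAB with ⟨rfl, rfl⟩ | ⟨rfl, rfl⟩
  · have hpow := h.min_exp_cut_mul_exp_cut_mul_pow_five_le hD hκ hd hA hB hcost hform hform' hcons
    rw [min_eq_left hcut] at hpow
    exact D.pow_three_mul_stageCost_le hm (disjoint_dataPart hd) hk hk1 hL hsq hpow
  · have hpow := h.min_exp_cut_mul_exp_cut_mul_pow_five_le hD hκ hd hB hA hcost hform hform' hcons
    rw [min_eq_right hcut, Finset.union_comm] at hpow
    rw [D.rest.contractionCost_comm] at hsq
    exact D.pow_three_mul_stageCost_le hm (disjoint_dataPart hd.symm) hk hk1 hL hsq hpow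

include hD in
lemma pow_three_mul_sum_stageCost_le (h : D.HasLargeRows F ord (k * m)) (hm : 0 < m)
    (hk : 0 ≤ k) (hk1 : k ≤ 1) (hT : T.IsFull) {T₀ : ContractionTree V} (hT₀ : T₀.leaves.Nodup)
    (hcon : T.ConstrainedOn T₀) :
    k ^ 3 * ∑ i, D.stageCost m (Alg.firstVerts D T₀ i) (Alg.secondVerts D T₀ i) ≤
      48 * T.cost (D.withEmbedding F) := by
  obtain ⟨n, hn, hverts⟩ := hcon.exists_injective hT₀
  have hstage (i : T₀.Contraction) :
      k ^ 3 * D.stageCost m (Alg.firstVerts D T₀ i) (Alg.secondVerts D T₀ i) ≤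
        12 * neighborCost (D.withEmbedding F) 0 T (n i) :=
    h.pow_three_mul_stageCost_le_neighborCost hD hm hk hk1 hT (n i)
      ((hverts i).trans (Alg.sym2_firstVerts_secondVerts D i).symm) (Alg.firstVerts_nonempty D i)
      (Alg.secondVerts_nonempty D i) (Alg.outerSize_firstVerts_le D i)
  have hinj : ∑ i, neighborCost (D.withEmbedding F) 0 T (n i) ≤
      ∑ j, neighborCost (D.withEmbedding F) 0 T j := by
    rw [← Finset.sum_image hn.injOn]
    exact Finset.sum_le_univ_sum_of_nonneg fun j =>
      (T.neighborCost_pos (D.withEmbedding F) le_rfl j).le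
  have htotal := T.sum_neighborCost_le (D.withEmbedding F) le_rfl
  have htop := T.topCost_nonneg (D.withEmbedding F)
  calc k ^ 3 * ∑ i, D.stageCost m (Alg.firstVerts D T₀ i) (Alg.secondVerts D T₀ i)
      = ∑ i, k ^ 3 * D.stageCost m (Alg.firstVerts D T₀ i) (Alg.secondVerts D T₀ i) :=
        Finset.mul_sum _ _ _
    _ ≤ ∑ i, 12 * neighborCost (D.withEmbedding F) 0 T (n i) :=
        Finset.sum_le_sum fun i _ => hstage i
    _ = 12 * ∑ i, neighborCost (D.withEmbedding F) 0 T (n i) := (Finset.mul_sum _ _ _).symm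
    _ ≤ 48 * T.cost (D.withEmbedding F) := by linarith

include hD in
lemma exp_cut_mul_size_mul_le_contractionCost (h : D.HasLargeRows F ord κ) (v : V)
    (hB : B.Nonempty) (hv : Disjoint {.inl v} B) :
    Real.exp (D.rest.cut {v}) * (D.size (Alg.edgeAt D hD v) * κ) ≤
      (D.withEmbedding F).contractionCost {.inl v} B := by
  obtain ⟨z, hz⟩ := (h.rowSystem hD).exists_isLast hB
  have hlast : (h.rowSystem hD).IsLast (.inl v) {.inl v} := by
    simp [TensorNetwork.RowSystem.IsLast]
  have hX := D.dataEdges_subset_edgesOf F ({.inl v} : Finset (V ⊕ VE))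
  rw [dataPart_singleton_inl] at hX
  have hrow : ∏ e ∈ (h.rowSystem hD).row (.inl v), ((D.withEmbedding F).dim e : ℝ) =
      D.size (Alg.edgeAt D hD v) := Finset.prod_singleton _ _
  rw [D.exp_cut_eq_prod_dataEdges F, ← hrow]
  refine le_trans ?_ (TensorNetwork.RowSystem.prod_mul_rows_le_contractionCost hv hlast hz
    (hX.trans Finset.subset_union_left) (D.disjoint_dataEdges_overallRow F hD _ _)
    (D.disjoint_dataEdges_overallRow F hD _ _))
  gcongr
  exact (h.rowSystem hD).le_prod z

lemma sum_exp_cut_mul_size_mul_le (h : D.HasLargeRows F ord κ) (hκ : 0 ≤ κ) (hT : T.IsFull)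
    (U : Finset V) :
    ∑ v ∈ U, Real.exp (D.rest.cut {v}) * (D.size (Alg.edgeAt D hD v) * κ) ≤
      2 * T.cost (D.withEmbedding F) := by
  rcases U.eq_empty_or_nonempty with rfl | ⟨u, -⟩
  · simpa using T.cost_nonneg (D.withEmbedding F)
  let g : V ⊕ VE → ℝ :=
    Sum.elim (fun v => Real.exp (D.rest.cut {v}) * (D.size (Alg.edgeAt D hD v) * κ)) fun _ => 0
  have hg0 (x : V ⊕ VE) : 0 ≤ g x := by
    rcases x with _ | _
    · exact mul_nonneg (Real.exp_pos _).le (mul_nonneg (Nat.cast_nonneg _) hκ)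
    · exact le_rfl
  have hg (x : V ⊕ VE) (B : Finset (V ⊕ VE)) (hB : B.Nonempty) (hd : Disjoint {x} B) :
      g x ≤ (D.withEmbedding F).contractionCost {x} B := by
    rcases x with v | v
    · exact h.exp_cut_mul_size_mul_le_contractionCost hD v hB hd
    · exact ((D.withEmbedding F).contractionCost_pos _ _).le
  calc ∑ v ∈ U, Real.exp (D.rest.cut {v}) * (D.size (Alg.edgeAt D hD v) * κ)
      = ∑ x ∈ U.map Function.Embedding.inl, g x := (Finset.sum_map U Function.Embedding.inl g).symm
    _ ≤ ∑ x ∈ T.verts, g x := Finset.sum_le_sum_of_subset_of_nonneg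
        (fun x _ => mem_verts.mpr (hT.2 x)) fun x _ _ => hg0 x
    _ ≤ 2 * T.cost (D.withEmbedding F) := by
      rcases T with x | ⟨l, r⟩
      · have hu := List.mem_singleton.mp (hT.2 (.inl u))
        have hinput := List.mem_singleton.mp (hT.2 (.inr (F.input (Alg.edgeAt D hD u))))
        exact (Sum.inl_ne_inr (hu.trans hinput.symm)).elim
      · exact sum_verts_node_le _ hg hT.1

end HasLargeRows

end DataNetwork

/-! ### Nodes and subtrees of a contraction tree -/

namespace ContractionTree

variable {V : Type*}

/-- The left (`false`) or right (`true`) child of a contraction. -/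
def child (t : ContractionTree V) (p : t.Contraction × Bool) : V ⊕ t.Contraction :=
  if p.2 then t.rightChild p.1 else t.leftChild p.1

/-- The vertices of the tree: its contractions and the labels of its leaves. -/
def IsNode (t : ContractionTree V) : V ⊕ t.Contraction → Prop
  | .inl v => v ∈ t.verts
  | .inr _ => True

section Child

variable {l r : ContractionTree V}

lemma ofLeft_injective :
    Function.Injective (ofLeft : V ⊕ l.Contraction → V ⊕ (node l r).Contraction) :=
  Function.injective_id.sumMap ((Option.some_injective _).comp Sum.inl_injective)

lemma ofRight_injective :
    Function.Injective (ofRight : V ⊕ r.Contraction → V ⊕ (node l r).Contraction) :=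
  Function.injective_id.sumMap ((Option.some_injective _).comp Sum.inr_injective)

lemma isNode_root : ∀ t : ContractionTree V, t.IsNode t.root
  | leaf _ => by simp [root, IsNode, verts_leaf]
  | node _ _ => trivial

lemma IsNode.ofLeft : ∀ {x}, l.IsNode x → (node l r).IsNode (ofLeft x)
  | .inl _, h => by
      change _ ∈ (node l r).verts
      rw [verts_node]
      exact Finset.mem_union_left _ h
  | .inr _, _ => trivial

lemma IsNode.ofRight : ∀ {x}, r.IsNode x → (node l r).IsNode (ofRight x)
  | .inl _, h => by
      change _ ∈ (node l r).verts
      rw [verts_node]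
      exact Finset.mem_union_right _ h
  | .inr _, _ => trivial

lemma isNode_node : ∀ {x}, (node l r).IsNode x →
    x = .inr none ∨ (∃ y, l.IsNode y ∧ x = ofLeft y) ∨ ∃ y, r.IsNode y ∧ x = ofRight y
  | .inl v, h => by
      change v ∈ (node l r).verts at h
      rw [verts_node] at h
      exact .inr ((Finset.mem_union.mp h).imp (⟨.inl v, ·, rfl⟩) (⟨.inl v, ·, rfl⟩))
  | .inr none, _ => .inl rfl
  | .inr (some (.inl i)), _ => .inr (.inl ⟨.inr i, trivial, rfl⟩)
  | .inr (some (.inr i)), _ => .inr (.inr ⟨.inr i, trivial, rfl⟩)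

lemma ofLeft_ne_ofRight (h : Disjoint l.verts r.verts) :
    ∀ {x y}, l.IsNode x → r.IsNode y → (ofLeft x : V ⊕ (node l r).Contraction) ≠ ofRight y
  | .inl v, .inl w, hx, hy => fun hxy => by
      obtain rfl : v = w := Sum.inl_injective hxy
      exact Finset.disjoint_left.mp h hx hy
  | .inl _, .inr _, _, _ => Sum.inl_ne_inr
  | .inr _, .inl _, _, _ => Sum.inr_ne_inl
  | .inr _, .inr _, _, _ => fun hxy =>
      Sum.inl_ne_inr (Option.some_injective _ (Sum.inr_injective hxy))

lemma child_inl (i : l.Contraction) (b : Bool) :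
    (node l r).child (some (.inl i), b) = ofLeft (l.child (i, b)) := by
  cases b <;> rfl

lemma child_inr (i : r.Contraction) (b : Bool) :
    (node l r).child (some (.inr i), b) = ofRight (r.child (i, b)) := by
  cases b <;> rfl

lemma isNode_child : ∀ (t : ContractionTree V) (p : t.Contraction × Bool), t.IsNode (t.child p)
  | leaf _, p => Empty.elim p.1
  | node l _, (none, false) => l.isNode_root.ofLeft
  | node _ r, (none, true) => r.isNode_root.ofRight
  | node l r, (some (.inl i), b) => by
      rw [child_inl]
      exact (l.isNode_child (i, b)).ofLeft
  | node l r, (some (.inr i), b) => by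
      rw [child_inr]
      exact (r.isNode_child (i, b)).ofRight

lemma eq_root_or_eq_child : ∀ (t : ContractionTree V) (x : V ⊕ t.Contraction), t.IsNode x →
    x = t.root ∨ ∃ p, x = t.child p
  | leaf v, .inl w, h => .inl (congrArg Sum.inl (by simpa [IsNode, verts_leaf] using h))
  | leaf _, .inr i, _ => Empty.elim i
  | node l r, x, h => by
      rcases isNode_node h with rfl | ⟨y, hy, rfl⟩ | ⟨y, hy, rfl⟩
      · exact .inl rfl
      · rcases l.eq_root_or_eq_child y hy with rfl | ⟨⟨i, b⟩, rfl⟩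
        · exact .inr ⟨(none, false), rfl⟩
        · exact .inr ⟨(some (.inl i), b), (child_inl i b).symm⟩
      · rcases r.eq_root_or_eq_child y hy with rfl | ⟨⟨i, b⟩, rfl⟩
        · exact .inr ⟨(none, true), rfl⟩
        · exact .inr ⟨(some (.inr i), b), (child_inr i b).symm⟩

lemma child_ne_root : ∀ (t : ContractionTree V) (p : t.Contraction × Bool), t.child p ≠ t.root
  | leaf _, p => Empty.elim p.1
  | node _ _, (none, false) => ofLeft_ne_none _
  | node _ _, (none, true) => ofRight_ne_none _
  | node _ _, (some (.inl i), b) => by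
      rw [child_inl]
      exact ofLeft_ne_none _
  | node _ _, (some (.inr i), b) => by
      rw [child_inr]
      exact ofRight_ne_none _

lemma child_none_ne_ofLeft_child (h : Disjoint l.verts r.verts) (q : l.Contraction × Bool) :
    ∀ b, (node l r).child (none, b) ≠ ofLeft (l.child q)
  | false => fun h' => l.child_ne_root q (ofLeft_injective h').symm
  | true => (ofLeft_ne_ofRight h (l.isNode_child q) r.isNode_root).symm

lemma child_none_ne_ofRight_child (h : Disjoint l.verts r.verts) (q : r.Contraction × Bool) :
    ∀ b, (node l r).child (none, b) ≠ ofRight (r.child q)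
  | false => ofLeft_ne_ofRight h l.isNode_root (r.isNode_child q)
  | true => fun h' => r.child_ne_root q (ofRight_injective h').symm

lemma child_none_injective (h : Disjoint l.verts r.verts) :
    Function.Injective fun b => (node l r).child (none, b) := by
  have hne := ofLeft_ne_ofRight h l.isNode_root r.isNode_root
  rintro (_ | _) (_ | _) hb
  exacts [rfl, (hne hb).elim, (hne hb.symm).elim, rfl]

lemma child_injective : ∀ (t : ContractionTree V), t.leaves.Nodup → Function.Injective t.child
  | leaf _, _ => fun p => Empty.elim p.1
  | node l r, h => by
      obtain ⟨hl, hr, hd⟩ := nodup_leaves_node.mp h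
      have left_ne_right (p q) := ofLeft_ne_ofRight hd (l.isNode_child p) (r.isNode_child q)
      rintro ⟨_ | i | i, b⟩ ⟨_ | j | j, b'⟩ hij
      · exact congrArg _ (child_none_injective hd hij)
      · exact (child_none_ne_ofLeft_child hd _ b (hij.trans (child_inl _ _))).elim
      · exact (child_none_ne_ofRight_child hd _ b (hij.trans (child_inr _ _))).elim
      · exact (child_none_ne_ofLeft_child hd _ b' (hij.symm.trans (child_inl _ _))).elim
      · rw [child_inl, child_inl] at hij
        obtain ⟨rfl, rfl⟩ := Prod.mk.inj (l.child_injective hl (ofLeft_injective hij))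
        rfl
      · rw [child_inl, child_inr] at hij
        exact (left_ne_right _ _ hij).elim
      · exact (child_none_ne_ofRight_child hd _ b' (hij.symm.trans (child_inr _ _))).elim
      · rw [child_inl, child_inr] at hij
        exact (left_ne_right _ _ hij.symm).elim
      · rw [child_inr, child_inr] at hij
        obtain ⟨rfl, rfl⟩ := Prod.mk.inj (r.child_injective hr (ofRight_injective hij))
        rfl

end Child

section NodeVerts

/-- The leaves below a vertex of the tree. -/
noncomputable def nodeVerts (t : ContractionTree V) : V ⊕ t.Contraction → Finset V
  | .inl v => {v}
  | .inr i => t.leftVerts i ∪ t.rightVerts i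

lemma nodeVerts_root : ∀ t : ContractionTree V, t.nodeVerts t.root = t.verts
  | leaf v => (verts_leaf v).symm
  | node l r => (verts_node l r).symm

lemma nodeVerts_ofLeft {l r : ContractionTree V} : ∀ x,
    (node l r).nodeVerts (ofLeft x) = l.nodeVerts x
  | .inl _ => rfl
  | .inr _ => rfl

lemma nodeVerts_ofRight {l r : ContractionTree V} : ∀ x,
    (node l r).nodeVerts (ofRight x) = r.nodeVerts x
  | .inl _ => rfl
  | .inr _ => rfl

lemma nodeVerts_leftChild : ∀ (t : ContractionTree V) (i : t.Contraction),
    t.nodeVerts (t.leftChild i) = t.leftVerts i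
  | leaf _, i => Empty.elim i
  | node l _, none => (nodeVerts_ofLeft _).trans l.nodeVerts_root
  | node l _, some (.inl i) => (nodeVerts_ofLeft _).trans (l.nodeVerts_leftChild i)
  | node _ r, some (.inr i) => (nodeVerts_ofRight _).trans (r.nodeVerts_leftChild i)

lemma nodeVerts_rightChild : ∀ (t : ContractionTree V) (i : t.Contraction),
    t.nodeVerts (t.rightChild i) = t.rightVerts i
  | leaf _, i => Empty.elim i
  | node _ r, none => (nodeVerts_ofRight _).trans r.nodeVerts_root
  | node l _, some (.inl i) => (nodeVerts_ofLeft _).trans (l.nodeVerts_rightChild i)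
  | node _ r, some (.inr i) => (nodeVerts_ofRight _).trans (r.nodeVerts_rightChild i)

lemma card_nodeVerts_child_lt (t : ContractionTree V) (ht : t.leaves.Nodup)
    (p : t.Contraction × Bool) :
    (t.nodeVerts (t.child p)).card < (t.nodeVerts (.inr p.1)).card := by
  obtain ⟨i, b⟩ := p
  change _ < (t.nodeVerts (.inr i)).card
  have hleft := (t.leftVerts_nonempty i).card_pos
  have hright := (t.rightVerts_nonempty i).card_pos
  have hunion : (t.nodeVerts (.inr i)).card = (t.leftVerts i).card + (t.rightVerts i).card :=
    Finset.card_union_of_disjoint (t.disjoint_leftVerts_rightVerts ht i)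
  rw [hunion]
  cases b
  · have h : t.nodeVerts (t.child (i, false)) = t.leftVerts i := t.nodeVerts_leftChild i
    rw [h]
    omega
  · have h : t.nodeVerts (t.child (i, true)) = t.rightVerts i := t.nodeVerts_rightChild i
    rw [h]
    omega

end NodeVerts

section Subtree

variable {T t l r : ContractionTree V}

/-- `t` is a subtree of `T`, and `f` is the inclusion of its contractions into those of `T`. -/
structure IsSubtree (T t : ContractionTree V) (f : t.Contraction → T.Contraction) : Prop where
  injective : Function.Injective f
  child : ∀ i b, T.child (f i, b) = Sum.map id f (t.child (i, b))
  leftVerts : ∀ i, T.leftVerts (f i) = t.leftVerts i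
  rightVerts : ∀ i, T.rightVerts (f i) = t.rightVerts i

lemma IsSubtree.refl (T : ContractionTree V) : IsSubtree T T id where
  injective := Function.injective_id
  child _ _ := by simp
  leftVerts _ := rfl
  rightVerts _ := rfl

lemma IsSubtree.left {f : (node l r).Contraction → T.Contraction}
    (h : IsSubtree T (node l r) f) : IsSubtree T l fun i => f (some (.inl i)) where
  injective := h.injective.comp ((Option.some_injective _).comp Sum.inl_injective)
  child i b := by
    refine (h.child (some (.inl i)) b).trans ((congrArg _ (child_inl i b)).trans ?_)
    exact Sum.map_map _ _ _ _ _
  leftVerts i := h.leftVerts _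
  rightVerts i := h.rightVerts _

lemma IsSubtree.right {f : (node l r).Contraction → T.Contraction}
    (h : IsSubtree T (node l r) f) : IsSubtree T r fun i => f (some (.inr i)) where
  injective := h.injective.comp ((Option.some_injective _).comp Sum.inr_injective)
  child i b := by
    refine (h.child (some (.inr i)) b).trans ((congrArg _ (child_inr i b)).trans ?_)
    exact Sum.map_map _ _ _ _ _
  leftVerts i := h.leftVerts _
  rightVerts i := h.rightVerts _

lemma IsSubtree.eq_root {f : t.Contraction → T.Contraction} (h : IsSubtree T t f)
    {y : V ⊕ t.Contraction} (hy : t.IsNode y)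
    (hx : ∀ i b, Sum.map id f y ≠ T.child (f i, b)) : y = t.root := by
  refine (t.eq_root_or_eq_child y hy).resolve_right ?_
  rintro ⟨⟨i, b⟩, rfl⟩
  exact hx i b (h.child i b).symm

end Subtree

end ContractionTree

/-! ### The edges of the embedding of the algorithm -/

namespace Embedding

variable {S VE EE : Type*} [Fintype EE] (F : Embedding S VE EE)

/-- The edges of the embedding that leave a set of data and embedding vertices. -/
noncomputable def edgesOf {V : Type*} (W : Finset (V ⊕ VE)) : Finset EE :=
  Finset.univ.filter fun e => (∃ u ∈ F.ends e, Sum.inr u ∈ W) ∧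
    ((∃ u ∈ F.ends e, Sum.inr u ∉ W) ∨ (F.ends e).card = 1)

variable {F} {V : Type*} {W : Finset (V ⊕ VE)} {e : EE}

lemma mem_edgesOf : e ∈ F.edgesOf W ↔ (∃ u ∈ F.ends e, Sum.inr u ∈ W) ∧
    ((∃ u ∈ F.ends e, Sum.inr u ∉ W) ∨ (F.ends e).card = 1) := by
  simp [edgesOf]

lemma edgesOf_union_subset [DecidableEq (V ⊕ VE)] [DecidableEq EE] (W W' : Finset (V ⊕ VE)) :
    F.edgesOf (W ∪ W') ⊆ F.edgesOf W ∪ F.edgesOf W' := by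
  intro e
  simp only [Finset.mem_union, mem_edgesOf, not_or]
  rintro ⟨⟨u, hu, hW | hW⟩, h⟩
  · exact .inl ⟨⟨u, hu, hW⟩, h.imp_left fun ⟨w, hw, hw'⟩ => ⟨w, hw, hw'.1⟩⟩
  · exact .inr ⟨⟨u, hu, hW⟩, h.imp_left fun ⟨w, hw, hw'⟩ => ⟨w, hw, hw'.2⟩⟩

lemma notMem_edgesOf (hcard : (F.ends e).card ≠ 1) (h : ∀ u ∈ F.ends e, Sum.inr u ∈ W) :
    e ∉ F.edgesOf W := by
  rw [mem_edgesOf]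
  rintro ⟨-, ⟨u, hu, hu'⟩ | hcard'⟩
  exacts [hu' (h u hu), hcard hcard']

lemma mem_ends_of_mem_edgesOf_singleton {u : VE}
    (he : e ∈ F.edgesOf ({.inr u} : Finset (V ⊕ VE))) : u ∈ F.ends e := by
  obtain ⟨⟨w, hw, hwu⟩, -⟩ := mem_edgesOf.mp he
  rwa [← Sum.inr_injective (Finset.mem_singleton.mp hwu)]

end Embedding

namespace Alg

open ContractionTree

variable {V E S : Type*} (D : DataNetwork V E S) (hD : Function.Surjective D.vertex)

lemma edgeAt_injective : Function.Injective (edgeAt D hD) := Function.injective_surjInv hD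

lemma edgeAt_vertex (s : S) : edgeAt D hD (D.vertex s) = s :=
  D.vertex_injective (D.vertex_edgeAt hD _)

lemma outTensor_injective {X : Type*} :
    Function.Injective (outTensor D hD : V ⊕ X → Vertex S X) := by
  rintro (v | i) (w | j) h
  · exact congrArg _ (edgeAt_injective D hD (Sum.inl_injective h))
  · exact (Sum.inl_ne_inr h).elim
  · exact (Sum.inr_ne_inl h).elim
  · exact congrArg _ (congrArg Prod.fst (Sum.inr_injective h))

lemma outTensor_ne_first {X : Type*} (x : V ⊕ X) (i : X) :
    outTensor D hD x ≠ .inr (i, 0) := by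
  rcases x with v | j <;> simp [outTensor]

variable [Fintype E] {T : ContractionTree V}

section Operands

variable (T)

/-- Whether the operand that is sketched first is the right one. -/
noncomputable def rightFirst (i : T.Contraction) : Bool :=
  decide ¬ LeftFirst D (T.leftVerts i) (T.rightVerts i)

lemma firstChild_eq (i : T.Contraction) : firstChild D T i = T.child (i, rightFirst D T i) := by
  by_cases h : LeftFirst D (T.leftVerts i) (T.rightVerts i) <;>
    simp [firstChild, rightFirst, child, h]

lemma secondChild_eq (i : T.Contraction) :
    secondChild D T i = T.child (i, !rightFirst D T i) := by
  by_cases h : LeftFirst D (T.leftVerts i) (T.rightVerts i) <;>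
    simp [secondChild, rightFirst, child, h]

lemma eq_firstChild_or_eq_secondChild : ∀ p : T.Contraction × Bool,
    T.child p = firstChild D T p.1 ∨ T.child p = secondChild D T p.1 := by
  rintro ⟨i, b⟩
  rw [firstChild_eq, secondChild_eq]
  cases b <;> cases rightFirst D T i <;> simp

variable {T}

lemma firstChild_inj (hT : T.leaves.Nodup) {i j : T.Contraction} :
    firstChild D T i = firstChild D T j ↔ i = j := by
  refine ⟨fun h => ?_, congrArg _⟩
  rw [firstChild_eq, firstChild_eq] at h
  exact congrArg Prod.fst (T.child_injective hT h)

lemma secondChild_inj (hT : T.leaves.Nodup) {i j : T.Contraction} :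
    secondChild D T i = secondChild D T j ↔ i = j := by
  refine ⟨fun h => ?_, congrArg _⟩
  rw [secondChild_eq, secondChild_eq] at h
  exact congrArg Prod.fst (T.child_injective hT h)

lemma firstChild_ne_secondChild (hT : T.leaves.Nodup) (i j : T.Contraction) :
    firstChild D T i ≠ secondChild D T j := by
  rw [firstChild_eq, secondChild_eq]
  intro h
  obtain ⟨rfl, h⟩ := Prod.mk.inj (T.child_injective hT h)
  simp at h

end Operands

section Source

variable (T)

/-- The vertex of the data contraction tree whose sketch dimension is carried by an edge of the
embedding. The inner edges `(i, 3)` of the small networks carry none. -/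
noncomputable def source : Edge T.Contraction → Option (V ⊕ T.Contraction)
  | none => T.root
  | some (i, 0) => firstChild D T i
  | some (i, 1) => secondChild D T i
  | some (i, 2) => secondChild D T i
  | some (_, 3) => none

/-- The edges of the embedding that carry the sketch dimension of a vertex of the tree. -/
noncomputable def outEdges (x : V ⊕ T.Contraction) : Finset (Edge T.Contraction) :=
  Finset.univ.filter fun e => source D T e = some x

variable {T}

lemma mem_outEdges {x : V ⊕ T.Contraction} {e : Edge T.Contraction} :
    e ∈ outEdges D T x ↔ source D T e = some x := by
  simp [outEdges]

lemma exists_eq_child_of_source {x : V ⊕ T.Contraction} {i : T.Contraction} {k : Fin 4}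
    (h : source D T (some (i, k)) = some x) : ∃ b, x = T.child (i, b) := by
  fin_cases k
  · exact ⟨_, (Option.some_injective _ h).symm.trans (firstChild_eq D T i)⟩
  · exact ⟨_, (Option.some_injective _ h).symm.trans (secondChild_eq D T i)⟩
  · exact ⟨_, (Option.some_injective _ h).symm.trans (secondChild_eq D T i)⟩
  · exact (Option.some_ne_none _ h.symm).elim

lemma source_none_ne_child (p : T.Contraction × Bool) :
    source D T none ≠ some (T.child p) :=
  fun h => T.child_ne_root p (Option.some_injective _ h).symm

lemma outEdges_root : outEdges D T T.root = {none} := by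
  ext e
  rw [mem_outEdges, Finset.mem_singleton]
  constructor
  · rcases e with _ | ⟨i, k⟩
    · exact fun _ => rfl
    · intro h
      obtain ⟨b, hb⟩ := exists_eq_child_of_source D h
      exact (T.child_ne_root _ hb.symm).elim
  · rintro rfl
    rfl

lemma outEdges_firstChild (hT : T.leaves.Nodup) (i : T.Contraction) :
    outEdges D T (firstChild D T i) = {some (i, 0)} := by
  have hne (j) := (firstChild_ne_secondChild D hT i j).symm
  have hroot := source_none_ne_child D (i, rightFirst D T i)
  rw [← firstChild_eq] at hroot
  ext (_ | ⟨j, k⟩)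
  · simpa [mem_outEdges] using hroot
  · fin_cases k <;> simp [mem_outEdges, source, firstChild_inj D hT, hne]

lemma outEdges_secondChild (hT : T.leaves.Nodup) (i : T.Contraction) :
    outEdges D T (secondChild D T i) = {some (i, 1), some (i, 2)} := by
  have hne := (firstChild_ne_secondChild D hT · i)
  have hroot := source_none_ne_child D (i, !rightFirst D T i)
  rw [← secondChild_eq] at hroot
  ext (_ | ⟨j, k⟩)
  · simpa [mem_outEdges] using hroot
  · fin_cases k <;> simp [mem_outEdges, source, secondChild_inj D hT, hne]

end Source

section Ends

variable {m : ℕ} {hm : 0 < m}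

lemma card_ends_some (p : T.Contraction × Fin 4) :
    ((embedding D hD T m hm).ends (some p)).card ≠ 1 := by
  obtain ⟨i, k⟩ := p
  fin_cases k
  · exact (Finset.card_pair (outTensor_ne_first D hD _ i)).trans_ne (by norm_num)
  · exact (Finset.card_pair (outTensor_ne_first D hD _ i)).trans_ne (by norm_num)
  · exact (Finset.card_pair (outTensor_secondChild_ne D hD T i)).trans_ne (by norm_num)
  · exact (Finset.card_pair (by simp)).trans_ne (by norm_num)

lemma mem_ends_outTensor {x : V ⊕ T.Contraction} {e : Edge T.Contraction} :
    outTensor D hD x ∈ (embedding D hD T m hm).ends e ↔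
      e ∈ outEdges D T x ∨ ∃ i, x = .inr i ∧ (e = some (i, 2) ∨ e = some (i, 3)) := by
  have hlast (j : T.Contraction) : outTensor D hD x = .inr (j, 1) ↔ x = .inr j :=
    ⟨fun h => outTensor_injective D hD h, fun h => h ▸ rfl⟩
  rw [mem_outEdges]
  rcases e with _ | ⟨j, k⟩
  · simp [embedding, source, (outTensor_injective D hD).eq_iff, eq_comm]
  · fin_cases k <;>
      simp [embedding, source, (outTensor_injective D hD).eq_iff,
        (outTensor_ne_first D hD _ _).symm, hlast, eq_comm]

lemma mem_ends_first {i : T.Contraction} {e : Edge T.Contraction} :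
    .inr (i, 0) ∈ (embedding D hD T m hm).ends e ↔
      e = some (i, 0) ∨ e = some (i, 1) ∨ e = some (i, 3) := by
  rcases e with _ | ⟨j, k⟩
  · simp [embedding, (outTensor_ne_first D hD _ _).symm]
  · fin_cases k <;> simp [embedding, (outTensor_ne_first D hD _ _).symm, eq_comm]

lemma eq_of_mem_ends_some {p : T.Contraction × Fin 4} {u : Vertex S T.Contraction}
    (hu : u ∈ (embedding D hD T m hm).ends (some p)) :
    (∃ k, u = .inr (p.1, k)) ∨ ∃ x, source D T (some p) = some x ∧ u = outTensor D hD x := by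
  obtain ⟨i, k⟩ := p
  fin_cases k <;> simp only [embedding, Finset.mem_insert, Finset.mem_singleton] at hu
  · exact hu.symm.imp (fun h => ⟨0, h⟩) fun h => ⟨_, rfl, h⟩
  · exact hu.symm.imp (fun h => ⟨0, h⟩) fun h => ⟨_, rfl, h⟩
  · exact hu.symm.imp (fun h => ⟨1, h⟩) fun h => ⟨_, rfl, h⟩
  · exact .inl (hu.elim (fun h => ⟨0, h⟩) fun h => ⟨1, h⟩)

end Ends

end Alg

/-! ### The contraction tree of the algorithm -/

namespace Alg

open ContractionTree

variable {V E S : Type*} [Fintype E] (D : DataNetwork V E S)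
  (hD : Function.Surjective D.vertex)

section Stage

variable {W : Type*} {L R : ContractionTree W} {z z' : W}

/-- The contraction tree `(((L, z), R), z')` that sketches a contraction of the data, `L` and `R`
being the trees of its operands and `z` and `z'` the tensors of the small network. -/
def stage (L R : ContractionTree W) (z z' : W) : ContractionTree W :=
  node (node (node L (leaf z)) R) (leaf z')

lemma mem_leaves_stage {w : W} :
    w ∈ (stage L R z z').leaves ↔ w = z ∨ w = z' ∨ w ∈ L.leaves ∨ w ∈ R.leaves := by
  simp only [stage, leaves, List.mem_append, List.mem_singleton]
  tauto

lemma nodup_leaves_stage (hL : L.leaves.Nodup) (hR : R.leaves.Nodup)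
    (hLR : L.leaves.Disjoint R.leaves) (hzL : z ∉ L.leaves) (hzR : z ∉ R.leaves)
    (hzL' : z' ∉ L.leaves) (hzR' : z' ∉ R.leaves) (hzz' : z ≠ z') :
    (stage L R z z').leaves.Nodup := by
  simp [stage, leaves, List.nodup_append', hL, hR, hLR, hzL, hzR, hzL', hzR', hzz']

lemma mem_contractions_stage {q : Finset W × Finset W} :
    q ∈ (stage L R z z').contractions ↔
      q = ((node (node L (leaf z)) R).verts, {z'}) ∨ q = ((node L (leaf z)).verts, R.verts) ∨
        q = (L.verts, {z}) ∨ q ∈ L.contractions ∨ q ∈ R.contractions := by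
  simp only [stage, contractions, verts_leaf, List.mem_cons, List.mem_append, List.append_nil]
  tauto

lemma cost_stage [DecidableEq W] {G : TensorNetwork W E} : (stage L R z z').cost G =
    G.contractionCost L.verts {z} + G.contractionCost (L.verts ∪ {z}) R.verts +
      G.contractionCost (L.verts ∪ {z} ∪ R.verts) {z'} + L.cost G + R.cost G := by
  simp only [stage, cost_node, cost_leaf, verts_node, verts_leaf]
  ring

end Stage

section TreeAux

variable {X : Type*}

lemma treeAux_node (l r : ContractionTree V) (f : (node l r).Contraction → X) :
    treeAux D hD (node l r) f =
      if LeftFirst D l.verts r.verts then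
        stage (treeAux D hD l fun i => f (some (.inl i)))
          (treeAux D hD r fun i => f (some (.inr i)))
          (.inr (.inr (f none, 0))) (.inr (.inr (f none, 1)))
      else
        stage (treeAux D hD r fun i => f (some (.inr i)))
          (treeAux D hD l fun i => f (some (.inl i)))
          (.inr (.inr (f none, 0))) (.inr (.inr (f none, 1))) :=
  rfl

lemma mem_leaves_treeAux_node {l r : ContractionTree V} {f : (node l r).Contraction → X}
    {w : V ⊕ Vertex S X} : w ∈ (treeAux D hD (node l r) f).leaves ↔
      (∃ k, w = .inr (.inr (f none, k))) ∨ w ∈ (treeAux D hD l fun i => f (some (.inl i))).leaves ∨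
        w ∈ (treeAux D hD r fun i => f (some (.inr i))).leaves := by
  rw [treeAux_node, Fin.exists_fin_two]
  split_ifs <;> rw [mem_leaves_stage] <;> tauto

lemma inl_mem_leaves_treeAux {v : V} : ∀ {t : ContractionTree V} {f : t.Contraction → X},
    Sum.inl v ∈ (treeAux D hD t f).leaves ↔ v ∈ t.leaves
  | leaf w, f => by simp [treeAux, leaves]
  | node l r, f => by
      rw [mem_leaves_treeAux_node, inl_mem_leaves_treeAux (t := l),
        inl_mem_leaves_treeAux (t := r)]
      simp [leaves]

lemma inr_inl_mem_leaves_treeAux {s : S} : ∀ {t : ContractionTree V} {f : t.Contraction → X},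
    Sum.inr (Sum.inl s) ∈ (treeAux D hD t f).leaves ↔ D.vertex s ∈ t.leaves
  | leaf w, f => by
      have hs : s = edgeAt D hD w ↔ D.vertex s = w :=
        ⟨fun h => h ▸ D.vertex_edgeAt hD w, fun h => h ▸ (edgeAt_vertex D hD s).symm⟩
      simp [treeAux, leaves, hs]
  | node l r, f => by
      rw [mem_leaves_treeAux_node, inr_inl_mem_leaves_treeAux (t := l),
        inr_inl_mem_leaves_treeAux (t := r)]
      simp [leaves]

lemma inr_inr_mem_leaves_treeAux {j : X} {k : Fin 2} :
    ∀ {t : ContractionTree V} {f : t.Contraction → X},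
      Sum.inr (Sum.inr (j, k)) ∈ (treeAux D hD t f).leaves ↔ j ∈ Set.range f
  | leaf w, f => by
      have hf : j ∉ Set.range f := by
        rintro ⟨i, -⟩
        exact Empty.elim i
      simp [treeAux, leaves, hf]
  | node l r, f => by
      rw [mem_leaves_treeAux_node, inr_inr_mem_leaves_treeAux (t := l),
        inr_inr_mem_leaves_treeAux (t := r)]
      refine Iff.trans ?_ exists_contraction_node.symm
      simp [eq_comm]

lemma disjoint_leaves_treeAux {t t' : ContractionTree V} {f : t.Contraction → X}
    {f' : t'.Contraction → X} (h : Disjoint t.verts t'.verts)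
    (hf : Disjoint (Set.range f) (Set.range f')) :
    (treeAux D hD t f).leaves.Disjoint (treeAux D hD t' f').leaves := by
  have hd {v} (hv : v ∈ t.leaves) (hv' : v ∈ t'.leaves) : False :=
    Finset.disjoint_left.mp h (mem_verts.mpr hv) (mem_verts.mpr hv')
  rintro (v | s | ⟨j, k⟩) hx hy
  · rw [inl_mem_leaves_treeAux] at hx hy
    exact hd hx hy
  · rw [inr_inl_mem_leaves_treeAux] at hx hy
    exact hd hx hy
  · rw [inr_inr_mem_leaves_treeAux] at hx hy
    exact Set.disjoint_left.mp hf hx hy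

lemma nodup_leaves_treeAux : ∀ {t : ContractionTree V} {f : t.Contraction → X},
    t.leaves.Nodup → Function.Injective f → (treeAux D hD t f).leaves.Nodup
  | leaf w, f, _, _ => by simp [treeAux, leaves]
  | node l r, f, h, hf => by
      obtain ⟨hl, hr, hd⟩ := nodup_leaves_node.mp h
      have ihl := nodup_leaves_treeAux hl
        (hf.comp ((Option.some_injective _).comp Sum.inl_injective))
      have ihr := nodup_leaves_treeAux hr
        (hf.comp ((Option.some_injective _).comp Sum.inr_injective))
      have hLR := disjoint_leaves_treeAux D hD (f := fun i => f (some (.inl i)))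
        (f' := fun i => f (some (.inr i))) hd <| Set.disjoint_left.mpr <| by
          rintro _ ⟨i, rfl⟩ ⟨j, hj⟩
          exact Sum.inr_ne_inl (Option.some_injective _ (hf hj))
      have hzL k : Sum.inr (Sum.inr (f none, k)) ∉
          (treeAux D hD l fun i => f (some (.inl i))).leaves := by
        rw [inr_inr_mem_leaves_treeAux]
        exact fun ⟨i, hi⟩ => Option.some_ne_none _ (hf hi)
      have hzR k : Sum.inr (Sum.inr (f none, k)) ∉
          (treeAux D hD r fun i => f (some (.inr i))).leaves := by
        rw [inr_inr_mem_leaves_treeAux]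
        exact fun ⟨i, hi⟩ => Option.some_ne_none _ (hf hi)
      rw [treeAux_node]
      split_ifs
      · exact nodup_leaves_stage ihl ihr hLR (hzL 0) (hzR 0) (hzL 1) (hzR 1) (by simp)
      · exact nodup_leaves_stage ihr ihl hLR.symm (hzR 0) (hzL 0) (hzR 1) (hzL 1) (by simp)

lemma dataPart_treeAux (t : ContractionTree V) (f : t.Contraction → X) :
    dataPart (treeAux D hD t f).verts = t.verts := by
  ext v
  rw [mem_dataPart, mem_verts, inl_mem_leaves_treeAux, mem_verts]

lemma dataPart_treeAux_first (t : ContractionTree V) (f : t.Contraction → X) (z : Vertex S X) :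
    dataPart (node (treeAux D hD t f) (leaf (.inr z))).verts = t.verts := by
  ext v
  simp [mem_dataPart, mem_verts, leaves, inl_mem_leaves_treeAux]

lemma constrainedOn_treeAux : ∀ (t : ContractionTree V) (f : t.Contraction → X),
    (treeAux D hD t f).ConstrainedOn t
  | leaf _, _ => fun p hp => by simp [contractions] at hp
  | node l r, f => fun p hp => by
      rw [contractions, List.mem_cons, List.mem_append] at hp
      rw [treeAux_node]
      split_ifs <;> simp only [mem_contractions_stage] <;> rcases hp with rfl | hp | hp
      on_goal 1 => exact ⟨_, .inr (.inl rfl), .inl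
        ⟨dataPart_treeAux_first D hD _ _ _, dataPart_treeAux D hD _ _⟩⟩
      on_goal 3 => exact ⟨_, .inr (.inl rfl), .inr
        ⟨dataPart_treeAux_first D hD _ _ _, dataPart_treeAux D hD _ _⟩⟩
      all_goals
        obtain ⟨q, hq, hpq⟩ := constrainedOn_treeAux _ _ p hp
        exact ⟨q, by tauto, hpq⟩

end TreeAux

variable {T : ContractionTree V}

lemma isFull_tree (hT : T.IsFull) : (tree D hD T).IsFull := by
  refine ⟨nodup_leaves_treeAux D hD hT.1 Function.injective_id, ?_⟩
  rintro (v | s | ⟨j, k⟩)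
  · exact (inl_mem_leaves_treeAux D hD).mpr (hT.2 v)
  · exact (inr_inl_mem_leaves_treeAux D hD).mpr (hT.2 _)
  · exact (inr_inr_mem_leaves_treeAux D hD).mpr ⟨j, rfl⟩

section EdgesOf

variable {m : ℕ} {hm : 0 < m} {t : ContractionTree V} {f : t.Contraction → T.Contraction}

lemma outTensor_mem_leaves_treeAux {x : V ⊕ T.Contraction} :
    Sum.inr (outTensor D hD x) ∈ (treeAux D hD t f).leaves ↔
      ∃ y, t.IsNode y ∧ x = Sum.map id f y := by
  rcases x with v | j
  · rw [outTensor, inr_inl_mem_leaves_treeAux, D.vertex_edgeAt hD]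
    constructor
    · exact fun h => ⟨.inl v, mem_verts.mpr h, rfl⟩
    · rintro ⟨w | i, hw, h⟩
      · exact Sum.inl_injective h ▸ mem_verts.mp hw
      · exact (Sum.inl_ne_inr h).elim
  · rw [outTensor, inr_inr_mem_leaves_treeAux]
    constructor
    · rintro ⟨i, rfl⟩
      exact ⟨.inr i, trivial, rfl⟩
    · rintro ⟨w | i, _, h⟩
      · exact (Sum.inr_ne_inl h).elim
      · exact ⟨i, (Sum.inr_injective h).symm⟩

lemma eq_map_root_of_outTensor_mem (h : IsSubtree T t f) {x : V ⊕ T.Contraction}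
    (hx : Sum.inr (outTensor D hD x) ∈ (treeAux D hD t f).leaves)
    (hchild : ∀ i b, x ≠ T.child (f i, b)) : x = Sum.map id f t.root := by
  obtain ⟨y, hy, rfl⟩ := (outTensor_mem_leaves_treeAux D hD).mp hx
  rw [h.eq_root hy hchild]

lemma edgesOf_treeAux_subset (hT : T.leaves.Nodup) (h : IsSubtree T t f) :
    (embedding D hD T m hm).edgesOf (treeAux D hD t f).verts ⊆
      outEdges D T (Sum.map id f t.root) := by
  intro e he
  obtain ⟨⟨u, hu, hut⟩, -⟩ := Embedding.mem_edgesOf.mp he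
  rw [mem_verts] at hut
  rw [mem_outEdges]
  rcases e with _ | ⟨j, k⟩
  · obtain rfl : u = outTensor D hD T.root := Finset.mem_singleton.mp hu
    have hroot := eq_map_root_of_outTensor_mem D hD h hut fun _ _ => (T.child_ne_root _).symm
    exact congrArg some hroot
  by_cases hj : j ∈ Set.range f
  · -- all the ends of the edge are in the subtree
    refine (Embedding.notMem_edgesOf (card_ends_some D hD (j, k)) (fun w hw => ?_) he).elim
    rw [mem_verts]
    rcases eq_of_mem_ends_some D hD hw with ⟨l, rfl⟩ | ⟨x, hx, rfl⟩
    · exact (inr_inr_mem_leaves_treeAux D hD).mpr hj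
    · obtain ⟨b, rfl⟩ := exists_eq_child_of_source D hx
      obtain ⟨i, rfl⟩ := hj
      exact (outTensor_mem_leaves_treeAux D hD).mpr ⟨_, t.isNode_child (i, b), h.child i b⟩
  · rcases eq_of_mem_ends_some D hD hu with ⟨l, rfl⟩ | ⟨x, hx, rfl⟩
    · exact (hj ((inr_inr_mem_leaves_treeAux D hD).mp hut)).elim
    · obtain ⟨b, rfl⟩ := exists_eq_child_of_source D hx
      rw [hx, eq_map_root_of_outTensor_mem D hD h hut fun i b' hb => hj
        ⟨i, (congrArg Prod.fst (T.child_injective hT hb)).symm⟩]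

lemma edgesOf_first_subset (i : T.Contraction) :
    (embedding D hD T m hm).edgesOf ({.inr (.inr (i, 0))} : Finset (V ⊕ Vertex S T.Contraction)) ⊆
      {some (i, 0), some (i, 1), some (i, 3)} := by
  intro e he
  simpa using (mem_ends_first D hD).mp (Embedding.mem_ends_of_mem_edgesOf_singleton he)

lemma edgesOf_leaf_subset (v : V) :
    (embedding D hD T m hm).edgesOf
      ({.inr (.inl (edgeAt D hD v))} : Finset (V ⊕ Vertex S T.Contraction)) ⊆
        outEdges D T (.inl v) := by
  intro e he
  rcases (mem_ends_outTensor D hD (x := .inl v)).mp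
    (Embedding.mem_ends_of_mem_edgesOf_singleton he) with h | ⟨i, hi, -⟩
  exacts [h, (Sum.inl_ne_inr hi).elim]

lemma edgesOf_last_subset (i : T.Contraction) :
    (embedding D hD T m hm).edgesOf ({.inr (.inr (i, 1))} : Finset (V ⊕ Vertex S T.Contraction)) ⊆
      outEdges D T (.inr i) ∪ {some (i, 2), some (i, 3)} := by
  intro e he
  rcases (mem_ends_outTensor D hD (x := .inr i)).mp
    (Embedding.mem_ends_of_mem_edgesOf_singleton he) with h | ⟨j, hj, h⟩
  · exact Finset.mem_union_left _ h
  · obtain rfl := Sum.inr_injective hj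
    exact Finset.mem_union_right _ (by simpa using h)

end EdgesOf

end Alg

namespace DataNetwork

open ContractionTree

variable {V E S VE EE : Type*} [Fintype S] (D : DataNetwork V E S) (F : Embedding S VE EE)

/-- The edges to be sketched that leave a set of data and embedding vertices. -/
noncomputable def inputsOf (A : Finset (V ⊕ VE)) : Finset S :=
  Finset.univ.filter fun s => ¬ (Sum.inl (D.vertex s) ∈ A ↔ Sum.inr (F.input s) ∈ A)

lemma mem_inputsOf {A : Finset (V ⊕ VE)} {s : S} :
    s ∈ D.inputsOf F A ↔ ¬ (Sum.inl (D.vertex s) ∈ A ↔ Sum.inr (F.input s) ∈ A) := by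
  simp [inputsOf]

lemma inputsOf_union_subset [DecidableEq (V ⊕ VE)] [DecidableEq S] (A B : Finset (V ⊕ VE)) :
    D.inputsOf F (A ∪ B) ⊆ D.inputsOf F A ∪ D.inputsOf F B := by
  intro s
  simp only [Finset.mem_union, mem_inputsOf]
  tauto

variable [Fintype E] [Fintype EE]

lemma edgesOf_withEmbedding (A : Finset (V ⊕ VE)) : (D.withEmbedding F).edgesOf A =
    (D.rest.edgesOf (dataPart A)).disjSum ((D.inputsOf F A).disjSum (F.edgesOf A)) := by
  ext (e | s | f)
  · rw [inl_mem_edgesOf, Finset.inl_mem_disjSum]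
  · simp only [TensorNetwork.mem_edgesOf, Finset.inr_mem_disjSum, Finset.inl_mem_disjSum,
      mem_inputsOf, withEmbedding, Finset.mem_insert, Finset.mem_singleton, exists_eq_or_imp,
      exists_eq_left, or_false]
    tauto
  · simp [TensorNetwork.mem_edgesOf, withEmbedding, Embedding.mem_edgesOf]

variable {D F} in
lemma contractionCost_withEmbedding_le [DecidableEq EE] {A B : Finset (V ⊕ VE)}
    {X : Finset E} {Y : Finset S} {Z : Finset EE}
    (hX : D.rest.edgesOf (dataPart A) ∪ D.rest.edgesOf (dataPart B) ⊆ X)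
    (hY : D.inputsOf F A ∪ D.inputsOf F B ⊆ Y) (hZ : F.edgesOf A ∪ F.edgesOf B ⊆ Z) :
    (D.withEmbedding F).contractionCost A B ≤
      (∏ e ∈ X, (D.rest.dim e : ℝ)) * ((∏ s ∈ Y, (D.size s : ℝ)) * ∏ f ∈ Z, (F.dim f : ℝ)) := by
  have hsub : (D.withEmbedding F).edgesOf A ∪ (D.withEmbedding F).edgesOf B ⊆
      X.disjSum (Y.disjSum Z) := by
    rw [Finset.union_subset_iff] at hX hY hZ ⊢
    rw [edgesOf_withEmbedding, edgesOf_withEmbedding]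
    exact ⟨Finset.disjSum_mono hX.1 (Finset.disjSum_mono hY.1 hZ.1),
      Finset.disjSum_mono hX.2 (Finset.disjSum_mono hY.2 hZ.2)⟩
  refine ((D.withEmbedding F).contractionCost_le_prod A B).trans
    (((D.withEmbedding F).prod_dim_mono hsub).trans_eq ?_)
  rw [Finset.prod_disjSum, Finset.prod_disjSum]
  rfl

end DataNetwork

namespace Embedding

variable {S VE EE : Type*} (F : Embedding S VE EE)

lemma prod_dim_union_le [DecidableEq EE] (s t : Finset EE) :
    ∏ f ∈ s ∪ t, (F.dim f : ℝ) ≤ (∏ f ∈ s, (F.dim f : ℝ)) * ∏ f ∈ t, (F.dim f : ℝ) := by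
  rw [← Finset.prod_union_inter]
  refine le_mul_of_one_le_right (Finset.prod_nonneg fun f _ => Nat.cast_nonneg _) ?_
  exact_mod_cast Finset.prod_pos fun f _ => F.dim_pos f

end Embedding

namespace Alg

open ContractionTree

variable {V E S : Type*} [Fintype E] (D : DataNetwork V E S)
  (hD : Function.Surjective D.vertex) {T : ContractionTree V} {m : ℕ} {hm : 0 < m}

section SketchDimension

variable {x : V ⊕ T.Contraction}

lemma outEdges_cases (hT : T.leaves.Nodup) (hx : T.IsNode x) :
    outEdges D T x = {none} ∨ (∃ i, outEdges D T x = {some (i, 0)}) ∨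
      ∃ i, outEdges D T x = {some (i, 1), some (i, 2)} := by
  rcases T.eq_root_or_eq_child x hx with rfl | ⟨p, rfl⟩
  · exact .inl (outEdges_root D)
  · refine .inr ((eq_firstChild_or_eq_secondChild D T p).imp (fun h => ?_) fun h => ?_)
    · exact ⟨p.1, h ▸ outEdges_firstChild D hT p.1⟩
    · exact ⟨p.1, h ▸ outEdges_secondChild D hT p.1⟩

lemma le_prod_outEdges (hT : T.leaves.Nodup) (hx : T.IsNode x) :
    m ≤ ∏ e ∈ outEdges D T x, (embedding D hD T m hm).dim e := by
  rcases outEdges_cases D hT hx with h | ⟨i, h⟩ | ⟨i, h⟩ <;> rw [h]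
  · rw [Finset.prod_singleton]
    exact le_rfl
  · rw [Finset.prod_singleton]
    exact le_rfl
  · rw [Finset.prod_pair (by simp)]
    exact D.le_splitSize_mul_cosplitSize hm _ _

lemma prod_outEdges_le (hT : T.leaves.Nodup) (hx : T.IsNode x) :
    ∏ e ∈ outEdges D T x, ((embedding D hD T m hm).dim e : ℝ) ≤ 2 * m := by
  have hm2 : (m : ℝ) ≤ 2 * m := by linarith [(m.cast_nonneg : (0 : ℝ) ≤ m)]
  rcases outEdges_cases D hT hx with h | ⟨i, h⟩ | ⟨i, h⟩ <;> rw [h]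
  · exact (Finset.prod_singleton _ _).trans_le hm2
  · exact (Finset.prod_singleton _ _).trans_le hm2
  · rw [Finset.prod_pair (by simp)]
    exact D.splitSize_mul_cosplitSize_le hm _ _

end SketchDimension

section InputsOf

variable [Fintype S]

lemma inputsOf_treeAux (t : ContractionTree V) (f : t.Contraction → T.Contraction) :
    D.inputsOf (embedding D hD T m hm) (treeAux D hD t f).verts = ∅ := by
  refine Finset.eq_empty_of_forall_notMem fun s hs => D.mem_inputsOf _ |>.mp hs ?_
  rw [mem_verts, mem_verts, inl_mem_leaves_treeAux]
  exact (inr_inl_mem_leaves_treeAux D hD).symm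

lemma inputsOf_singleton_inr_inr (p : T.Contraction × Fin 2) :
    D.inputsOf (embedding D hD T m hm) ({.inr (.inr p)} : Finset (V ⊕ Vertex S _)) = ∅ := by
  refine Finset.eq_empty_of_forall_notMem fun s hs => D.mem_inputsOf _ |>.mp hs ?_
  simp [embedding]

end InputsOf

/-- `P` and `Q` are the subtrees of the operands of the contraction `i` that are sketched first and
second, and `f` and `g` are the inclusions of their contractions. -/
structure IsOperands (i : T.Contraction) (P Q : ContractionTree V)
    (f : P.Contraction → T.Contraction) (g : Q.Contraction → T.Contraction) : Prop where
  isSubtree_first : IsSubtree T P f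
  isSubtree_second : IsSubtree T Q g
  firstChild_eq : firstChild D T i = Sum.map id f P.root
  secondChild_eq : secondChild D T i = Sum.map id g Q.root
  firstVerts_eq : firstVerts D T i = P.verts
  secondVerts_eq : secondVerts D T i = Q.verts

section IsOperands

variable {l r : ContractionTree V} {f : (node l r).Contraction → T.Contraction}

lemma leftChild_of_isSubtree (hf : IsSubtree T (node l r) f) :
    T.leftChild (f none) = Sum.map id (fun i => f (some (.inl i))) l.root :=
  (hf.child none false).trans (Sum.map_map _ _ _ _ _)

lemma rightChild_of_isSubtree (hf : IsSubtree T (node l r) f) :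
    T.rightChild (f none) = Sum.map id (fun i => f (some (.inr i))) r.root :=
  (hf.child none true).trans (Sum.map_map _ _ _ _ _)

variable {D}

lemma isOperands_of_leftFirst (hf : IsSubtree T (node l r) f) (h : LeftFirst D l.verts r.verts) :
    IsOperands D (f none) l r (fun i => f (some (.inl i))) fun i => f (some (.inr i)) := by
  have hl : T.leftVerts (f none) = l.verts := hf.leftVerts none
  have hr : T.rightVerts (f none) = r.verts := hf.rightVerts none
  constructor
  · exact hf.left
  · exact hf.right
  · rw [firstChild, hl, hr, if_pos h, leftChild_of_isSubtree hf]
  · rw [secondChild, hl, hr, if_pos h, rightChild_of_isSubtree hf]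
  · rw [firstVerts, hl, hr, if_pos h]
  · rw [secondVerts, hl, hr, if_pos h]

lemma isOperands_of_not_leftFirst (hf : IsSubtree T (node l r) f)
    (h : ¬ LeftFirst D l.verts r.verts) :
    IsOperands D (f none) r l (fun i => f (some (.inr i))) fun i => f (some (.inl i)) := by
  have hl : T.leftVerts (f none) = l.verts := hf.leftVerts none
  have hr : T.rightVerts (f none) = r.verts := hf.rightVerts none
  constructor
  · exact hf.right
  · exact hf.left
  · rw [firstChild, hl, hr, if_neg h, rightChild_of_isSubtree hf]
  · rw [secondChild, hl, hr, if_neg h, leftChild_of_isSubtree hf]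
  · rw [firstVerts, hl, hr, if_neg h]
  · rw [secondVerts, hl, hr, if_neg h]

end IsOperands

section StageEdges

variable {D} {i : T.Contraction} {P Q : ContractionTree V} {f : P.Contraction → T.Contraction}
  {g : Q.Contraction → T.Contraction}

lemma IsOperands.edgesOf_firstTree_subset (h : IsOperands D i P Q f g) (hT : T.leaves.Nodup) :
    (embedding D hD T m hm).edgesOf (treeAux D hD P f).verts ⊆ {some (i, 0)} := by
  have hsub := edgesOf_treeAux_subset D hD (hm := hm) hT h.isSubtree_first
  rwa [← h.firstChild_eq, outEdges_firstChild D hT] at hsub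

lemma IsOperands.edgesOf_secondTree_subset (h : IsOperands D i P Q f g) (hT : T.leaves.Nodup) :
    (embedding D hD T m hm).edgesOf (treeAux D hD Q g).verts ⊆ {some (i, 1), some (i, 2)} := by
  have hsub := edgesOf_treeAux_subset D hD (hm := hm) hT h.isSubtree_second
  rwa [← h.secondChild_eq, outEdges_secondChild D hT] at hsub

lemma IsOperands.outTensor_firstChild_mem (h : IsOperands D i P Q f g) :
    Sum.inr (outTensor D hD (firstChild D T i)) ∈ (treeAux D hD P f).verts :=
  mem_verts.mpr ((outTensor_mem_leaves_treeAux D hD).mpr ⟨_, P.isNode_root, h.firstChild_eq⟩)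

lemma IsOperands.outTensor_secondChild_mem (h : IsOperands D i P Q f g) :
    Sum.inr (outTensor D hD (secondChild D T i)) ∈ (treeAux D hD Q g).verts :=
  mem_verts.mpr ((outTensor_mem_leaves_treeAux D hD).mpr ⟨_, Q.isNode_root, h.secondChild_eq⟩)

lemma IsOperands.edgesOf_firstStep_subset (h : IsOperands D i P Q f g) (hT : T.leaves.Nodup) :
    (embedding D hD T m hm).edgesOf ((treeAux D hD P f).verts ∪ {.inr (.inr (i, 0))}) ⊆
      {some (i, 1), some (i, 3)} := by
  have hzero : some (i, 0) ∉ (embedding D hD T m hm).edgesOf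
      ((treeAux D hD P f).verts ∪ {.inr (.inr (i, 0))}) := by
    refine Embedding.notMem_edgesOf (card_ends_some D hD _) fun u hu => ?_
    rcases Finset.mem_insert.mp hu with rfl | hu
    · exact Finset.mem_union_left _ (h.outTensor_firstChild_mem hD)
    · rw [Finset.mem_singleton.mp hu]
      exact Finset.mem_union_right _ (Finset.mem_singleton_self _)
  intro e he
  have hne : e ≠ some (i, 0) := fun h' => hzero (h' ▸ he)
  rcases Finset.mem_union.mp (Embedding.edgesOf_union_subset _ _ he) with h' | h'
  · exact (hne (Finset.mem_singleton.mp (h.edgesOf_firstTree_subset hD hT h'))).elim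
  · exact Finset.mem_of_mem_insert_of_ne (edgesOf_first_subset D hD i h') hne

lemma IsOperands.edgesOf_secondStep_subset (h : IsOperands D i P Q f g) (hT : T.leaves.Nodup) :
    (embedding D hD T m hm).edgesOf
      ((treeAux D hD P f).verts ∪ {.inr (.inr (i, 0))} ∪ (treeAux D hD Q g).verts) ⊆
        {some (i, 2), some (i, 3)} := by
  have hone : some (i, 1) ∉ (embedding D hD T m hm).edgesOf
      ((treeAux D hD P f).verts ∪ {.inr (.inr (i, 0))} ∪ (treeAux D hD Q g).verts) := by
    refine Embedding.notMem_edgesOf (card_ends_some D hD _) fun u hu => ?_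
    rcases Finset.mem_insert.mp hu with rfl | hu
    · exact Finset.mem_union_right _ (h.outTensor_secondChild_mem hD)
    · rw [Finset.mem_singleton.mp hu]
      exact Finset.mem_union_left _ (Finset.mem_union_right _ (Finset.mem_singleton_self _))
  intro e he
  have hne : e ≠ some (i, 1) := fun h' => hone (h' ▸ he)
  rcases Finset.mem_union.mp (Embedding.edgesOf_union_subset _ _ he) with h' | h'
  · exact Finset.mem_insert_of_mem
      (Finset.mem_of_mem_insert_of_ne (h.edgesOf_firstStep_subset hD hT h') hne)
  · have := Finset.mem_of_mem_insert_of_ne (h.edgesOf_secondTree_subset hD hT h') hne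
    exact Finset.mem_insert.mpr (.inl (Finset.mem_singleton.mp this))

end StageEdges

end Alg

/-! ### The cost of the algorithm -/

namespace Alg

open ContractionTree

variable {V E S : Type*} [Fintype E] [Fintype S] {D : DataNetwork V E S}
  (hD : Function.Surjective D.vertex) {T : ContractionTree V} {m : ℕ} {hm : 0 < m}

section Stage

variable {i : T.Contraction} {P Q : ContractionTree V} {f : P.Contraction → T.Contraction}
  {g : Q.Contraction → T.Contraction}

lemma inputsOf_firstStep (P : ContractionTree V) (f : P.Contraction → T.Contraction)
    (p : T.Contraction × Fin 2) : D.inputsOf (embedding D hD T m hm)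
      ((treeAux D hD P f).verts ∪ {.inr (.inr p)}) = ∅ := by
  refine Finset.subset_empty.mp ((D.inputsOf_union_subset _ _ _).trans_eq ?_)
  rw [inputsOf_treeAux, inputsOf_singleton_inr_inr, Finset.union_empty]

lemma inputsOf_secondStep (P Q : ContractionTree V) (f : P.Contraction → T.Contraction)
    (g : Q.Contraction → T.Contraction) (p : T.Contraction × Fin 2) :
    D.inputsOf (embedding D hD T m hm)
      ((treeAux D hD P f).verts ∪ {.inr (.inr p)} ∪ (treeAux D hD Q g).verts) = ∅ := by
  refine Finset.subset_empty.mp ((D.inputsOf_union_subset _ _ _).trans_eq ?_)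
  rw [inputsOf_firstStep, inputsOf_treeAux, Finset.union_empty]

lemma IsOperands.cost_firstStep_le (h : IsOperands D i P Q f g) (hT : T.leaves.Nodup) :
    (D.withEmbedding (embedding D hD T m hm)).contractionCost (treeAux D hD P f).verts
        {.inr (.inr (i, 0))} ≤
      Real.exp (D.rest.cut (firstVerts D T i)) *
        (m * D.splitSize m (firstVerts D T i) (secondVerts D T i) * m) := by
  refine (D.contractionCost_withEmbedding_le (X := D.rest.edgesOf P.verts) (Y := ∅)
    (Z := {some (i, 0), some (i, 1), some (i, 3)}) ?_ ?_ ?_).trans_eq ?_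
  · rw [dataPart_treeAux, dataPart_singleton_inr, D.rest.edgesOf_empty, Finset.union_empty]
  · rw [inputsOf_treeAux, inputsOf_singleton_inr_inr, Finset.union_empty]
  · refine Finset.union_subset ((h.edgesOf_firstTree_subset hD hT).trans ?_)
      (Alg.edgesOf_first_subset D hD i)
    simp
  · rw [← D.rest.exp_cut, ← h.firstVerts_eq, Finset.prod_empty, one_mul,
      Finset.prod_insert (by simp), Finset.prod_pair (by simp), mul_assoc (m : ℝ)]
    rfl

lemma IsOperands.cost_secondStep_le (h : IsOperands D i P Q f g) (hT : T.leaves.Nodup)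
    (hPQ : Disjoint P.verts Q.verts) :
    (D.withEmbedding (embedding D hD T m hm)).contractionCost
        ((treeAux D hD P f).verts ∪ {.inr (.inr (i, 0))}) (treeAux D hD Q g).verts ≤
      D.rest.contractionCost (firstVerts D T i) (secondVerts D T i) *
        (D.splitSize m (firstVerts D T i) (secondVerts D T i) *
          D.cosplitSize m (firstVerts D T i) (secondVerts D T i) * m) := by
  refine (D.contractionCost_withEmbedding_le
    (X := D.rest.edgesOf P.verts ∪ D.rest.edgesOf Q.verts) (Y := ∅)
    (Z := {some (i, 1), some (i, 2), some (i, 3)}) ?_ ?_ ?_).trans_eq ?_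
  · rw [dataPart_union, dataPart_treeAux, dataPart_treeAux, dataPart_singleton_inr,
      Finset.union_empty]
  · rw [inputsOf_firstStep, inputsOf_treeAux, Finset.union_empty]
  · refine Finset.union_subset ((h.edgesOf_firstStep_subset hD hT).trans ?_)
      ((h.edgesOf_secondTree_subset hD hT).trans ?_)
    · exact Finset.insert_subset_insert _ (Finset.subset_insert _ _)
    · exact Finset.insert_subset_insert _ (by simp)
  · rw [← D.rest.contractionCost_eq_prod hPQ, ← h.firstVerts_eq, ← h.secondVerts_eq,
      Finset.prod_empty, one_mul, Finset.prod_insert (by simp), Finset.prod_pair (by simp),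
      mul_assoc (D.splitSize _ _ _ : ℝ)]
    rfl

lemma IsOperands.cost_thirdStep_le (h : IsOperands D i P Q f g) (hT : T.leaves.Nodup) :
    (D.withEmbedding (embedding D hD T m hm)).contractionCost
        ((treeAux D hD P f).verts ∪ {.inr (.inr (i, 0))} ∪ (treeAux D hD Q g).verts)
        {.inr (.inr (i, 1))} ≤
      Real.exp (D.rest.cut (firstVerts D T i ∪ secondVerts D T i)) *
        (D.cosplitSize m (firstVerts D T i) (secondVerts D T i) * m * (2 * m)) := by
  refine (D.contractionCost_withEmbedding_le (X := D.rest.edgesOf (P.verts ∪ Q.verts)) (Y := ∅)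
    (Z := {some (i, 2), some (i, 3)} ∪ outEdges D T (.inr i)) ?_ ?_ ?_).trans ?_
  · rw [dataPart_union, dataPart_union, dataPart_treeAux, dataPart_treeAux,
      dataPart_singleton_inr, dataPart_singleton_inr, D.rest.edgesOf_empty, Finset.union_empty,
      Finset.union_empty]
  · rw [inputsOf_secondStep, inputsOf_singleton_inr_inr, Finset.union_empty]
  · refine Finset.union_subset ((h.edgesOf_secondStep_subset hD hT).trans
      Finset.subset_union_left) ((edgesOf_last_subset D hD i).trans_eq (Finset.union_comm _ _))
  · rw [← D.rest.exp_cut, ← h.firstVerts_eq, ← h.secondVerts_eq, Finset.prod_empty, one_mul]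
    gcongr
    refine ((embedding D hD T m hm).prod_dim_union_le _ _).trans ?_
    rw [Finset.prod_pair (by simp)]
    exact mul_le_mul_of_nonneg_left (prod_outEdges_le D hD hT trivial) (by positivity)

lemma IsOperands.cost_stage_le (h : IsOperands D i P Q f g) (hT : T.leaves.Nodup)
    (hPQ : Disjoint P.verts Q.verts) :
    (stage (treeAux D hD P f) (treeAux D hD Q g) (.inr (.inr (i, 0))) (.inr (.inr (i, 1)))).cost
        (D.withEmbedding (embedding D hD T m hm)) ≤
      D.stageCost m (firstVerts D T i) (secondVerts D T i) +
      ((treeAux D hD P f).cost (D.withEmbedding (embedding D hD T m hm)) +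
        (treeAux D hD Q g).cost (D.withEmbedding (embedding D hD T m hm))) := by
  have h₁ := h.cost_firstStep_le hD hT (hm := hm)
  have h₂ := h.cost_secondStep_le hD hT hPQ (hm := hm)
  have h₃ := h.cost_thirdStep_le hD hT (hm := hm)
  rw [cost_stage, DataNetwork.stageCost, ← D.exp_cut_left, ← D.exp_cut_union]
  linarith

end Stage

lemma cost_treeAux_leaf_le (hT : T.leaves.Nodup) {v : V} (hv : v ∈ T.verts)
    (f : (leaf v).Contraction → T.Contraction) :
    (treeAux D hD (leaf v) f).cost (D.withEmbedding (embedding D hD T m hm)) ≤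
      2 * (Real.exp (D.rest.cut {v}) * D.size (edgeAt D hD v) * m) := by
  rw [treeAux, cost_node, cost_leaf, cost_leaf, add_zero, add_zero, verts_leaf, verts_leaf]
  refine (D.contractionCost_withEmbedding_le (X := D.rest.edgesOf {v}) (Y := {edgeAt D hD v})
    (Z := outEdges D T (.inl v)) ?_ ?_ ?_).trans ?_
  · rw [dataPart_singleton_inl, dataPart_singleton_inr, D.rest.edgesOf_empty, Finset.union_empty]
  · refine Finset.union_subset (fun s hs => ?_) fun s hs => ?_
    · rw [DataNetwork.mem_inputsOf] at hs
      have hsv : D.vertex s = v := by simpa [embedding] using hs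
      rw [Finset.mem_singleton, ← hsv, edgeAt_vertex]
    · rw [DataNetwork.mem_inputsOf] at hs
      simpa [embedding] using hs
  · refine Finset.union_subset (fun e he => ?_) (edgesOf_leaf_subset D hD v)
    simp [Embedding.mem_edgesOf] at he
  · rw [← D.rest.exp_cut, Finset.prod_singleton]
    calc _ ≤ Real.exp (D.rest.cut {v}) * (D.size (edgeAt D hD v) * (2 * m)) := by
          gcongr
          exact prod_outEdges_le D hD hT hv
      _ = _ := by ring

lemma cost_treeAux_le (hT : T.leaves.Nodup) : ∀ (t : ContractionTree V)
    (f : t.Contraction → T.Contraction), IsSubtree T t f → t.leaves.Nodup → t.verts ⊆ T.verts →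
    (treeAux D hD t f).cost (D.withEmbedding (embedding D hD T m hm)) ≤
      2 * ∑ v ∈ t.verts, Real.exp (D.rest.cut {v}) * D.size (edgeAt D hD v) * m +
      ∑ i, D.stageCost m (firstVerts D T (f i)) (secondVerts D T (f i))
  | leaf v, f, _, _, hv => by
      rw [verts_leaf, Finset.singleton_subset_iff] at hv
      have hzero : ∑ i, D.stageCost m (firstVerts D T (f i)) (secondVerts D T (f i)) = 0 :=
        Finset.sum_empty
      rw [hzero, add_zero, verts_leaf, Finset.sum_singleton]
      exact cost_treeAux_leaf_le hD hT hv f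
  | node l r, f, hf, ht, hv => by
      obtain ⟨hl, hr, hd⟩ := nodup_leaves_node.mp ht
      rw [verts_node] at hv ⊢
      have ihl := cost_treeAux_le hT l _ hf.left hl (Finset.union_subset_left hv)
      have ihr := cost_treeAux_le hT r _ hf.right hr (Finset.union_subset_right hv)
      rw [sum_contraction_node, Finset.sum_union hd, treeAux_node]
      split_ifs with h
      · have := (isOperands_of_leftFirst hf h).cost_stage_le hD hT hd (hm := hm)
        linarith
      · have := (isOperands_of_not_leftFirst hf h).cost_stage_le hD hT hd.symm (hm := hm)
        linarith

lemma cost_tree_le (hT : T.leaves.Nodup) :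
    (tree D hD T).cost (D.withEmbedding (embedding D hD T m hm)) ≤
      2 * ∑ v ∈ T.verts, Real.exp (D.rest.cut {v}) * D.size (edgeAt D hD v) * m +
      ∑ i, D.stageCost m (firstVerts D T i) (secondVerts D T i) :=
  cost_treeAux_le hD hT T id (IsSubtree.refl T) hT subset_rfl

end Alg

/-! ### The class of embeddings -/

lemma exists_injective_refinement {α : Type*} [Finite α] (key : α → ℕ) :
    ∃ ord : α → ℕ, Function.Injective ord ∧ ∀ a b, key a < key b → ord a < ord b := by
  obtain ⟨n, ⟨idx⟩⟩ := Finite.exists_equiv_fin α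
  have hlt (a b : α) (h : key a < key b) : key a * n + idx a < key b * n + idx b :=
    calc key a * n + idx a < (key a + 1) * n := by linarith [(idx a).isLt]
      _ ≤ key b * n := Nat.mul_le_mul_right n h
      _ ≤ key b * n + idx b := Nat.le_add_right _ _
  refine ⟨fun a => key a * n + idx a, fun a b hab => idx.injective (Fin.ext ?_), hlt⟩
  have hkey : key a = key b := le_antisymm
    (not_lt.mp fun h => (hlt b a h).ne hab.symm) (not_lt.mp fun h => (hlt a b h).ne hab)
  simpa [hkey] using hab

namespace Alg

open ContractionTree

variable {V E S : Type*}

lemma card_vertex [Fintype S] {D : DataNetwork V E S} (hD : Function.Surjective D.vertex)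
    {T : ContractionTree V} (hT : T.IsFull) :
    (Fintype.card (Vertex S T.Contraction) : ℝ) = 3 * Fintype.card S - 2 := by
  have hleaves : T.leaves.toFinset = Finset.univ.map ⟨D.vertex, D.vertex_injective⟩ := by
    ext v
    simpa [hT.2 v] using hD v
  have hS : Fintype.card S = T.leaves.length := by
    rw [← List.toFinset_card_of_nodup hT.1, hleaves, Finset.card_map, Finset.card_univ]
  have hcard : Fintype.card (Vertex S T.Contraction) + 2 = 3 * Fintype.card S := by
    have := T.card_contraction
    rw [Fintype.card_sum, Fintype.card_prod, Fintype.card_fin]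
    omega
  rw [eq_sub_iff_add_eq]
  exact_mod_cast hcard

/-- A position for every embedding tensor: the Kronecker factors come first, then the small
networks by increasing number of data tensors that they sketch. -/
noncomputable def key {T : ContractionTree V} : Vertex S T.Contraction → ℕ
  | .inl _ => 0
  | .inr (i, k) => 2 * (T.nodeVerts (.inr i)).card + k

variable (D : DataNetwork V E S) (hD : Function.Surjective D.vertex) {T : ContractionTree V}

lemma key_outTensor_child_lt (hT : T.leaves.Nodup) (p : T.Contraction × Bool) (k : Fin 2) :
    key (outTensor D hD (T.child p)) < key (.inr (p.1, k) : Vertex S T.Contraction) := by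
  have h := T.card_nodeVerts_child_lt hT p
  rcases hx : T.child p with v | j
  · simp only [outTensor, key]
    omega
  · rw [hx] at h
    simp only [outTensor, key]
    omega

variable {m : ℕ} (hm : 0 < m) [Fintype E]

lemma outputs_embedding : (embedding D hD T m hm).outputs = {none} := by
  ext e
  rw [Embedding.outputs, Finset.mem_filter, Finset.mem_singleton]
  rcases e with _ | p
  · simp [embedding]
  · simp [card_ends_some]

lemma sketchSize_embedding : (embedding D hD T m hm).sketchSize = m := by
  rw [Embedding.sketchSize, outputs_embedding, Finset.prod_singleton]
  rfl

section Row

variable {D hm} {ord : Vertex S T.Contraction → ℕ}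
  (hord : ∀ a b, key a < key b → ord a < ord b)

include hord

lemma outEdges_subset_row (hT : T.leaves.Nodup) (x : V ⊕ T.Contraction) :
    outEdges D T x ⊆ (embedding D hD T m hm).row ord (outTensor D hD x) := by
  intro e he
  refine (Embedding.mem_row _).mpr ⟨(mem_ends_outTensor D hD).mpr (.inl he), ?_⟩
  rcases e with _ | ⟨i, k⟩
  · exact .inl (Finset.card_singleton _)
  · obtain ⟨b, rfl⟩ := exists_eq_child_of_source D ((mem_outEdges D).mp he)
    have hend : ∃ j, .inr (i, j) ∈ (embedding D hD T m hm).ends (some (i, k)) := by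
      fin_cases k
      exacts [⟨0, by simp [embedding]⟩, ⟨0, by simp [embedding]⟩, ⟨1, by simp [embedding]⟩,
        ⟨0, by simp [embedding]⟩]
    obtain ⟨j, hj⟩ := hend
    exact .inr ⟨_, hj, hord _ _ (key_outTensor_child_lt D hD hT (i, b) j)⟩

lemma inner_edge_mem_row (i : T.Contraction) :
    some (i, 3) ∈ (embedding D hD T m hm).row ord (.inr (i, 0)) :=
  (Embedding.mem_row _).mpr ⟨(mem_ends_first D hD).mpr (.inr (.inr rfl)),
    .inr ⟨.inr (i, 1), by simp [embedding], hord _ _ (by simp [key])⟩⟩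

lemma le_rowSize_embedding (hT : T.IsFull) (v : Vertex S T.Contraction) :
    m ≤ (embedding D hD T m hm).rowSize ord v := by
  have hout (x : V ⊕ T.Contraction) (hx : T.IsNode x) :
      m ≤ (embedding D hD T m hm).rowSize ord (outTensor D hD x) :=
    (le_prod_outEdges D hD hT.1 hx).trans
      (Embedding.prod_le_rowSize _ (outEdges_subset_row hD hord hT.1 x))
  rcases v with s | ⟨i, k⟩
  · have h := hout (.inl (D.vertex s)) (mem_verts.mpr (hT.2 _))
    rwa [outTensor, edgeAt_vertex] at h
  · fin_cases k
    · have h := Embedding.prod_le_rowSize _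
        (Finset.singleton_subset_iff.mpr (inner_edge_mem_row hD (m := m) (hm := hm) hord i))
      rwa [Finset.prod_singleton] at h
    · exact hout (.inr i) trivial

end Row

variable [Fintype S]

lemma inClass_embedding (hT : T.IsFull) {c₁ c₂ ε δ : ℝ}
    (h₁ : c₁ * scale ε δ (3 * Fintype.card S - 2) ≤ m)
    (h₂ : m ≤ c₂ * scale ε δ (3 * Fintype.card S - 2)) :
    (embedding D hD T m hm).InClass c₁ c₂ ε δ where
  one_output := by rw [outputs_embedding, Finset.card_singleton]
  accurate := by
    obtain ⟨ord, hinj, hord⟩ := exists_injective_refinement (key (S := S) (T := T))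
    refine ⟨ord, hinj, fun v => ?_⟩
    rw [card_vertex hD hT]
    exact h₁.trans (Nat.cast_le.mpr (le_rowSize_embedding hD hord hT v))
  sketchSize_ge := by rwa [card_vertex hD hT, sketchSize_embedding]
  sketchSize_le := by rwa [card_vertex hD hT, sketchSize_embedding]

end Alg

lemma Embedding.InClass.exists_le_rowSize {S VE EE : Type*} [Fintype VE] [Fintype EE]
    {F : Embedding S VE EE} {c₁ c₂ ε δ : ℝ} (hF : F.InClass c₁ c₂ ε δ) (hc₁ : 0 < c₁)
    (hc₂ : 0 < c₂) (hδ : 0 < δ) (hδ1 : δ < 1) {n m : ℝ}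
    (hn : c₁ * scale ε δ n ≤ F.sketchSize) (hm : m ≤ c₂ * scale ε δ (3 * n - 2)) :
    ∃ ord : VE → ℕ, ∀ v, c₁ ^ 2 / (3 * c₂ ^ 2) * m ≤ F.rowSize ord v := by
  obtain ⟨ord, -, hord⟩ := hF.accurate
  refine ⟨ord, fun v => le_trans ?_ (hord v)⟩
  have hsize := hn.trans hF.sketchSize_le
  simp only [scale, mul_div_assoc] at hsize hm ⊢
  set κ := Real.log (1 / δ) / ε ^ 2
  have hκ : 0 ≤ κ := div_nonneg (Real.log_nonneg ((one_le_div hδ).mpr hδ1.le)) (sq_nonneg ε)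
  calc c₁ ^ 2 / (3 * c₂ ^ 2) * m ≤ c₁ ^ 2 / (3 * c₂ ^ 2) * (c₂ * (3 * n * κ)) := by
        gcongr
        refine hm.trans ?_
        gcongr
        linarith
    _ = c₁ / c₂ * (c₁ * (n * κ)) := by field_simp
    _ ≤ c₁ / c₂ * (c₂ * (Fintype.card VE * κ)) := by gcongr
    _ = c₁ * (Fintype.card VE * κ) := by field_simp

end

end TNSketch

open TNSketch in
theorem theorem4p2 (c₁ c₂ : ℝ) (hc₁ : 0 < c₁) (hc₂ : 0 < c₂) :
    ∃ C : ℝ, 0 < C ∧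
      ∀ (V E S : Type*) [Fintype V] [Fintype E] [Fintype S] (D : DataNetwork V E S)
        (hD : Function.Surjective D.vertex)
        (T₀ : ContractionTree V), T₀.IsFull →
      ∀ ε δ : ℝ, 0 < ε → 0 < δ → δ < 1 →
      ∀ (m : ℕ) (hm : 0 < m),
        c₁ * scale ε δ (3 * Fintype.card S - 2) ≤ m →
        m ≤ c₂ * scale ε δ (3 * Fintype.card S - 2) →
        (∀ s : S, m < D.size s) →
        (Alg.embedding D hD T₀ m hm).InClass c₁ c₂ ε δ ∧
        (Alg.embedding D hD T₀ m hm).sketchSize = m ∧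
        (Alg.tree D hD T₀).IsFull ∧
        (Alg.tree D hD T₀).ConstrainedOn T₀ ∧
        ∀ (VE EE : Type*) [Fintype VE] [Fintype EE] (F : Embedding S VE EE),
          F.InClass c₁ c₂ ε δ →
          c₁ * scale ε δ (Fintype.card S) ≤ F.sketchSize →
          ∀ T : ContractionTree (V ⊕ VE), T.IsFull → T.ConstrainedOn T₀ →
            (Alg.tree D hD T₀).cost (D.withEmbedding (Alg.embedding D hD T₀ m hm)) ≤
              C * T.cost (D.withEmbedding F) := by
  obtain ⟨k, hk, hk1, hkc⟩ : ∃ k : ℝ, 0 < k ∧ k ≤ 1 ∧ k ≤ c₁ ^ 2 / (3 * c₂ ^ 2) :=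
    ⟨min 1 (c₁ ^ 2 / (3 * c₂ ^ 2)), lt_min one_pos (by positivity), min_le_left _ _,
      min_le_right _ _⟩
  refine ⟨48 / k ^ 3 + 4 / k, by positivity, ?_⟩
  intro V E S _ _ _ D hD T₀ hT₀ ε δ _ hδ hδ1 m hm h₁ h₂ hsize
  refine ⟨Alg.inClass_embedding D hD hm hT₀ h₁ h₂, Alg.sketchSize_embedding D hD hm,
    Alg.isFull_tree D hD hT₀, Alg.constrainedOn_treeAux D hD T₀ id, ?_⟩
  intro VE EE _ _ F hF hsketch T hT hcon
  obtain ⟨ord, hord⟩ := hF.exists_le_rowSize hc₁ hc₂ hδ hδ1 hsketch h₂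
  have hrows : D.HasLargeRows F ord (k * m) :=
    { le_size := fun s => (mul_le_of_le_one_left m.cast_nonneg hk1).trans
        (Nat.cast_le.mpr (hsize s).le)
      le_rowSize := fun v => (mul_le_mul_of_nonneg_right hkc m.cast_nonneg).trans (hord v)
      one_output := hF.one_output }
  have hstages := hrows.pow_three_mul_sum_stageCost_le hD hm hk.le hk1 hT hT₀.1 hcon
  have hleaves := hrows.sum_exp_cut_mul_size_mul_le hD (by positivity) hT T₀.verts
  simp only [mul_left_comm _ k, ← Finset.mul_sum] at hleaves
  rw [← le_div_iff₀' (by positivity)] at hstages hleaves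
  simp only [← mul_assoc] at hleaves
  calc _ ≤ _ := Alg.cost_tree_le hD hT₀.1
    _ ≤ 2 * (2 * T.cost (D.withEmbedding F) / k) + 48 * T.cost (D.withEmbedding F) / k ^ 3 := by
      gcongr
    _ = _ := by ring
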